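/- Let $K$ be a number field with ring of integers $\mathcal O$ and with exactly $r=2$ archimedean places, and let $K_1,K_2$ be the corresponding completions (each isomorphic to $\mathbb R$ or $\mathbb C$). Put $G=\mathrm{SL}(2,K_1)\times \mathrm{SL}(2,K_2)$, let $\Gamma$ be the image of $\mathrm{SL}(2,\mathcal O)$ in $G$ under the diagonal embedding, and let $\pi:G\to G/\Gamma$ be the projection; $G/\Gamma$ is the Hilbert modular space of rank $2$. Let $D_i$ be the connected component of the identity in the diagonal subgroup of $\mathrm{SL}(2,K_i)$, let $D_{i,\mathbb R}$ be the connected component of the identity in the subgroup of real matrices in $D_i$, and put $D=D_1\times D_2$, $D_{\mathbb R}=D_{1,\mathbb R}\times D_{2,\mathbb R}$. An orbit $D\pi(g)$ is called locally divergent if for each $i=1,2$ the orbit map $D_i\to G/\Gamma$, $d\mapsto d\,\pi(g)$, is proper. A Borel measure $\mu$ on $G/\Gamma$ is called algebraic if there is a closed subgroup $F$ of $G$ containing $D_{\mathbb R}$ such that $\mu$ is $F$-invariant and $\mathrm{supp}(\mu)=Fx$ for some $x\in G/\Gamma$. Then: (a) For every $g\in G$ such that the orbit $D\pi(g)$ is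 locally divergent, either $D\pi(g)$ is closed, or there are an integer $s$ with $2\le s\le 4$ and elements $h_1,\dots,h_s\in G$ such that $$\overline{D\pi(g)}\setminus D\pi(g)=\bigcup_{i=1}^{s}D\pi(h_i)$$ and $D\pi(h_1),\dots,D\pi(h_s)$ are pairwise different, closed, non-compact orbits. (b) There exists a nonzero, $\sigma$-finite, $D$-invariant, $D$-ergodic, non-algebraic Borel measure on $G/\Gamma$. -/

import Mathlib

open scoped NumberField MatrixGroups
open MeasureTheory NumberField

noncomputable section

namespace HilbertModular

/-- The identity component `H°` of a subgroup `H` of a topological group,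
as a subgroup of the ambient group. -/
def identityComponent {G : Type*} [TopologicalSpace G] [Group G] [IsTopologicalGroup G]
    (H : Subgroup G) : Subgroup G :=
  (Subgroup.connectedComponentOfOne H).map H.subtype

/-- The subgroup of diagonal matrices in `SL(2, L)`. -/
def diagonalSubgroup (L : Type*) [Field L] : Subgroup SL(2, L) where
  carrier := {A | A 0 1 = 0 ∧ A 1 0 = 0}
  one_mem' := by simp
  mul_mem' := by
    rintro A B ⟨hA, hA'⟩ ⟨hB, hB'⟩
    simp [Matrix.mul_apply, Fin.sum_univ_two, hA, hA', hB, hB']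
  inv_mem' := by
    rintro A ⟨hA, hA'⟩
    constructor <;>
      simp [Matrix.SpecialLinearGroup.coe_inv, Matrix.adjugate_fin_two, hA, hA']

variable (K : Type*) [Field K] [NumberField K]

/-- The group `G = ∏ SL(2, K_v)`, the product being over the archimedean places `v` of `K`,
with the product topology. -/
abbrev G : Type _ := (v : InfinitePlace K) → SL(2, v.Completion)

/-- The diagonal embedding `SL(2, 𝓞 K) → G`. -/
def diagonalEmbedding : SL(2, 𝓞 K) →* G K :=
  MonoidHom.pi fun v : InfinitePlace K =>
    Matrix.SpecialLinearGroup.map ((algebraMap K v.Completion).comp (algebraMap (𝓞 K) K))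

/-- `Γ`: the image of `SL(2, 𝓞 K)` in `G`. -/
def Gam : Subgroup (G K) := (diagonalEmbedding K).range

/-- The Hilbert modular space `G / Γ`, with the quotient topology. -/
abbrev Space : Type _ := G K ⧸ Gam K

/-- `G / Γ` carries its Borel `σ`-algebra, so a `Measure (Space K)` is a Borel measure. -/
instance : MeasurableSpace (Space K) := borel (Space K)

instance : BorelSpace (Space K) := ⟨rfl⟩

/-- The projection `π : G → G / Γ`. -/
def proj (g : G K) : Space K := QuotientGroup.mk g

variable {K}

/-- The connected component of the diagonal subgroup of `SL(2, K_v)`. -/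
def torusAt (v : InfinitePlace K) : Subgroup SL(2, v.Completion) :=
  identityComponent (diagonalSubgroup v.Completion)

/-- The matrices in `SL(2, K_v)` with real entries. -/
def realMatrices (v : InfinitePlace K) : Subgroup SL(2, v.Completion) :=
  (Matrix.SpecialLinearGroup.map (n := Fin 2) Complex.ofRealHom).range.comap
    (Matrix.SpecialLinearGroup.map (InfinitePlace.Completion.extensionEmbedding v))

/-- The connected component of the subgroup of real matrices in the diagonal torus
of `SL(2, K_v)`. -/
def realTorusAt (v : InfinitePlace K) : Subgroup SL(2, v.Completion) :=
  identityComponent (torusAt v ⊓ realMatrices v)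

/-- The factor `D_v` of the diagonal torus, as a subgroup of `G`
(trivial at the places other than `v`). -/
def factor (v : InfinitePlace K) : Subgroup (G K) where
  carrier := {g | g v ∈ torusAt v ∧ ∀ w, w ≠ v → g w = 1}
  one_mem' := ⟨one_mem _, fun _ _ => rfl⟩
  mul_mem' := by
    rintro a b ⟨ha, ha'⟩ ⟨hb, hb'⟩
    exact ⟨mul_mem ha hb, fun w hw => by simp [ha' w hw, hb' w hw]⟩
  inv_mem' := by
    rintro a ⟨ha, ha'⟩
    exact ⟨inv_mem ha, fun w hw => by simp [ha' w hw]⟩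

variable (K)

/-- The torus `D = ∏ D_v`. -/
def D : Subgroup (G K) := Subgroup.pi Set.univ fun v => torusAt v

/-- The real split torus `D_ℝ = ∏ D_{v,ℝ}`. -/
def realD : Subgroup (G K) := Subgroup.pi Set.univ fun v => realTorusAt v

variable {K}

/-- The orbit `D x`. -/
def orbitD (x : Space K) : Set (Space K) := MulAction.orbit (D K) x

/-- The orbit `H x` is divergent: the orbit map `h ↦ h x` is proper. -/
def IsDivergent (H : Subgroup (G K)) (x : Space K) : Prop :=
  IsProperMap fun h : H => h • x

/-- The orbit `D x` is locally divergent: `D_v x` is divergent for every archimedean `v`. -/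
def IsLocallyDivergent (x : Space K) : Prop :=
  ∀ v : InfinitePlace K, IsDivergent (factor v) x

/-- A Borel measure `μ` on `G / Γ` is algebraic: it is invariant under a closed subgroup `F` of
`G` containing `D_ℝ`, and its support is a single `F`-orbit. -/
def IsAlgebraic (μ : Measure (Space K)) : Prop :=
  ∃ F : Subgroup (G K), IsClosed (F : Set (G K)) ∧ realD K ≤ F ∧
    SMulInvariantMeasure F (Space K) μ ∧
    ∃ x : Space K, μ.support = MulAction.orbit F x

end HilbertModular

end

/-!
# Locally divergent torus orbits on Hilbert modular spaces of rank two

An element `g` of `G` is studied through the linear forms on `K²` given by the rows of its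
components `g_v`. Four ideas carry the proof.

*Locally divergent points are rational* (`rational_of_isLocallyDivergent`): if `D_v π(g)` is
divergent, both rows of `g_v` have a nonzero kernel in `K²`. Otherwise, along the one-parameter
group of `D_v` expanding a row without kernel, every line of `K²` is eventually expanded, while
Minkowski's theorem (`exists_short_vector`) provides a short vector at all times. By connectedness
of the half line, two independent short vectors exist simultaneously at arbitrarily large times.
Their determinants are integers of bounded size, so finitely many congruence classes occur and the
orbit returns to a compact set. Minkowski's theorem only needs that `D` preserves Haar measure on
`∏ K_v²`, which holds because exchanging the coordinates conjugates `D` to its inverse.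

*Limit points of orbits of rational points.* If `d π(g)` converges, then the heights of the vectors
`d g k` are bounded below (`exists_height_bound`). Taking for `k` the kernels of the rows, one finds
that `d` either stays bounded or expands one row `j v` at each place, at comparable rates, and that
the rows `j v` have no common kernel (`exists_direction`). In such a direction `g` may be multiplied
by shears along the rows `j v` without affecting the limit (`tendsto_shears_mul`), as `d` contracts
these shears. A suitable shear produces a point `h` all of whose rows have their kernels among
two lines of `K²` (`exists_companion`). Its orbit is closed, because its stabilizer in `D` contains
a hyperbolic element given by a unit (`Matched.isClosed_orbit`), and using the same unit the whole
orbit `D π(h)` is seen to lie in the closure of `D π(g)`.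

*Counting.* There are four possible directions `j`. Recording which pairs of rows at the two places
have a common kernel is an invariant of an orbit. If two complementary directions have a common
kernel, then `D π(g)` is closed. Otherwise each of the two pairs of complementary directions
contributes a boundary orbit, orbits from different pairs being distinguished by the
invariant (`boundary_of_not_matched`).

*The measure* is the image of Haar measure of `D` on a non-closed orbit of a rational point. It is
ergodic because `D` acts ergodically on itself, and `σ`-finite because the stabilizer is compact.
If it were algebraic, some `f` in a group preserving it would move `p = π(g)` to the boundary of
`D p`. Conjugating the real torus by `f` gives a flow keeping `p` inside `D p` for small times;
as `Γ` is countable, a nontrivial element of this flow lies in `D`, so `f` normalizes `D`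
and moves the conull orbit `D p` to the null boundary (`not_isAlgebraic_of_support`).
-/

namespace HilbertModular

open Filter Topology

set_option linter.unusedSectionVars false

variable {K : Type*} [Field K] [NumberField K]

/-! ### The integers in the completions -/

/-- The embedding of the ring of integers in the completion `K_v`. -/
noncomputable def emb (v : InfinitePlace K) : 𝓞 K →+* v.Completion :=
  (algebraMap K v.Completion).comp (algebraMap (𝓞 K) K)

lemma norm_emb (v : InfinitePlace K) (x : 𝓞 K) : ‖emb v x‖ = v (x : K) := by
  have h : emb v x = (((WithAbs.equiv v.1).symm (x : K) : WithAbs v.1) : v.Completion) := rfl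
  rw [h, InfinitePlace.Completion.norm_coe]
  simp

lemma emb_ne_zero (v : InfinitePlace K) {x : 𝓞 K} (hx : x ≠ 0) : emb v x ≠ 0 := by
  rw [← norm_ne_zero_iff, norm_emb]
  simpa using hx

lemma emb_eq_zero_iff (v : InfinitePlace K) {x : 𝓞 K} : emb v x = 0 ↔ x = 0 :=
  ⟨fun h => by_contra fun hx => emb_ne_zero v hx h, fun h => by simp [h]⟩

/-- The normalized absolute values of a nonzero integer have product at least `1`. -/
lemma one_le_prod_norm_emb {x : 𝓞 K} (hx : x ≠ 0) :
    1 ≤ ∏ v : InfinitePlace K, ‖emb v x‖ ^ v.mult := by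
  simp_rw [norm_emb]
  rw [InfinitePlace.prod_eq_abs_norm, ← Algebra.coe_norm_int]
  have h : Algebra.norm ℤ x ≠ 0 := Algebra.norm_ne_zero_iff.mpr hx
  exact_mod_cast Int.one_le_abs h

lemma finite_norm_emb_le (B : ℝ) : {x : 𝓞 K | ∀ v : InfinitePlace K, ‖emb v x‖ ≤ B}.Finite := by
  refine ((Embeddings.finite_of_norm_le K ℂ B).preimage
    (f := fun x : 𝓞 K => (x : K)) RingOfIntegers.coe_injective.injOn).subset ?_
  intro x hx
  refine ⟨x.isIntegral_coe, fun φ => ?_⟩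
  have := hx (InfinitePlace.mk φ)
  rwa [norm_emb, InfinitePlace.apply] at this

instance : Countable (𝓞 K) := by
  have h : (Set.univ : Set (𝓞 K)) ⊆
      ⋃ n : ℕ, {x : 𝓞 K | ∀ v : InfinitePlace K, ‖emb v x‖ ≤ n} := by
    intro x _
    obtain ⟨n, hn⟩ := exists_nat_ge (∑ v : InfinitePlace K, ‖emb v x‖)
    refine Set.mem_iUnion.2 ⟨n, fun v => le_trans ?_ hn⟩
    exact Finset.single_le_sum (f := fun v : InfinitePlace K => ‖emb v x‖)
      (fun _ _ => norm_nonneg _) (Finset.mem_univ v)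
  exact Set.countable_univ_iff.1
    ((Set.countable_iUnion fun n => (finite_norm_emb_le _).countable).mono h)

/-! ### Topology of `G` and of `G / Γ` -/

lemma isClosedEmbedding_extensionEmbedding (v : InfinitePlace K) :
    IsClosedEmbedding (InfinitePlace.Completion.extensionEmbedding v) :=
  (InfinitePlace.Completion.isometry_extensionEmbedding v).isClosedEmbedding

instance (v : InfinitePlace K) : ProperSpace v.Completion where
  isCompact_closedBall x r := by
    have := (isClosedEmbedding_extensionEmbedding v).isCompact_preimage
      (isCompact_closedBall (InfinitePlace.Completion.extensionEmbedding v x) r)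
    rwa [(InfinitePlace.Completion.isometry_extensionEmbedding v).preimage_closedBall] at this

instance (v : InfinitePlace K) : SecondCountableTopology v.Completion :=
  (isClosedEmbedding_extensionEmbedding v).isEmbedding.secondCountableTopology

lemma isClosedEmbedding_coe (v : InfinitePlace K) :
    IsClosedEmbedding fun (A : SL(2, v.Completion)) (i j : Fin 2) => A i j :=
  Matrix.SpecialLinearGroup.isClosedEmbedding_val

instance (v : InfinitePlace K) : SecondCountableTopology SL(2, v.Completion) :=
  (isClosedEmbedding_coe v).isEmbedding.secondCountableTopology

instance (v : InfinitePlace K) : LocallyCompactSpace SL(2, v.Completion) :=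
  (isClosedEmbedding_coe v).locallyCompactSpace

instance : LocallyCompactSpace (G K) := Pi.locallyCompactSpace_of_finite

lemma continuous_entry (v : InfinitePlace K) (i j : Fin 2) :
    Continuous fun g : G K => g v i j :=
  (continuous_apply j).comp ((continuous_apply i).comp
    ((continuous_subtype_val : Continuous fun A : SL(2, v.Completion) => A.1).comp
      (continuous_apply v)))

/-- A family in `G` converges as soon as all matrix entries do. -/
lemma tendsto_of_entries {ι : Type*} {l : Filter ι} {u : ι → G K} {g : G K}
    (h : ∀ v i j, Tendsto (fun a => u a v i j) l (𝓝 (g v i j))) : Tendsto u l (𝓝 g) := by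
  rw [tendsto_pi_nhds]
  intro v
  rw [(isClosedEmbedding_coe v).isEmbedding.tendsto_nhds_iff]
  rw [tendsto_pi_nhds]
  intro i
  rw [tendsto_pi_nhds]
  exact h v i

lemma isCompact_entries_le (B : ℝ) : IsCompact {g : G K | ∀ v i j, ‖g v i j‖ ≤ B} := by
  have h : ∀ v : InfinitePlace K,
      IsCompact {A : SL(2, v.Completion) | ∀ i j, ‖A i j‖ ≤ B} := by
    intro v
    have h2 : IsCompact {A : Fin 2 → Fin 2 → v.Completion | ∀ i j, A i j ∈
        Metric.closedBall (0 : v.Completion) B} := by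
      have := isCompact_univ_pi fun _ : Fin 2 => isCompact_univ_pi fun _ : Fin 2 =>
        isCompact_closedBall (0 : v.Completion) B
      convert! this using 1
      ext A
      simp [Set.mem_pi]
    have h3 := (isClosedEmbedding_coe v).isCompact_preimage h2
    refine Eq.mp (congrArg IsCompact (Set.ext fun A => ?_)) h3
    simp
  have := isCompact_univ_pi h
  convert! this using 1
  ext g
  simp [Set.mem_pi]

lemma isOpen_entries_lt (B : ℝ) : IsOpen {g : G K | ∀ v i j, ‖g v i j‖ < B} := by
  simp only [Set.ofPred_forall]
  exact isOpen_iInter_of_finite fun v => isOpen_iInter_of_finite fun i =>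
    isOpen_iInter_of_finite fun j => isOpen_lt (continuous_entry v i j).norm continuous_const

lemma exists_entries_lt (g : G K) : ∃ B : ℝ, 0 < B ∧ ∀ v i j, ‖g v i j‖ < B := by
  refine ⟨1 + ∑ v, ∑ i, ∑ j, ‖g v i j‖, by positivity, fun v i j => ?_⟩
  have h1 : ‖g v i j‖ ≤ ∑ j, ‖g v i j‖ :=
    Finset.single_le_sum (f := fun j => ‖g v i j‖) (fun _ _ => norm_nonneg _) (Finset.mem_univ j)
  have h2 : ∑ j, ‖g v i j‖ ≤ ∑ i, ∑ j, ‖g v i j‖ :=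
    Finset.single_le_sum (f := fun i => ∑ j, ‖g v i j‖) (fun _ _ => by positivity)
      (Finset.mem_univ i)
  have h3 : ∑ i, ∑ j, ‖g v i j‖ ≤ ∑ v, ∑ i, ∑ j, ‖g v i j‖ :=
    Finset.single_le_sum (f := fun v => ∑ i, ∑ j, ‖g v i j‖) (fun _ _ => by positivity)
      (Finset.mem_univ v)
  linarith

lemma diagonalEmbedding_apply (γ : SL(2, 𝓞 K)) (v : InfinitePlace K) (i j : Fin 2) :
    diagonalEmbedding K γ v i j = emb v (γ i j) := rfl

lemma isClosed_Gam : IsClosed (Gam K : Set (G K)) := by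
  rw [← closure_subset_iff_isClosed]
  intro y hy
  obtain ⟨B, -, hB⟩ := exists_entries_lt y
  have hfin : ((Gam K : Set (G K)) ∩ {g : G K | ∀ v i j, ‖g v i j‖ < B}).Finite := by
    have h1 : {M : Fin 2 → Fin 2 → 𝓞 K | ∀ i j, M i j ∈
        {x : 𝓞 K | ∀ v : InfinitePlace K, ‖emb v x‖ ≤ B}}.Finite := by
      have := Set.Finite.pi' (ι := Fin 2) fun _ => Set.Finite.pi' (ι := Fin 2) fun _ =>
        finite_norm_emb_le (K := K) B
      exact this
    refine ((h1.preimage (f := fun γ : SL(2, 𝓞 K) => (γ.1 : Fin 2 → Fin 2 → 𝓞 K))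
      (Subtype.val_injective.injOn)).image (diagonalEmbedding K)).subset ?_
    rintro _ ⟨⟨γ, rfl⟩, hγ⟩
    exact ⟨γ, fun i j v => (hγ v i j).le, rfl⟩
  have hy2 : y ∈ closure ((Gam K : Set (G K)) ∩ {g : G K | ∀ v i j, ‖g v i j‖ < B}) :=
    Set.inter_comm _ _ ▸ (isOpen_entries_lt B).inter_closure ⟨hB, hy⟩
  rw [hfin.isClosed.closure_eq] at hy2
  exact hy2.1

lemma proj_eq_iff {a b : G K} : proj K a = proj K b ↔ a⁻¹ * b ∈ Gam K := QuotientGroup.eq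

instance : T2Space (Space K) := by
  refine (t2Space_iff_of_isOpenQuotientMap
    (QuotientGroup.isOpenQuotientMap_mk (N := Gam K))).2 ?_
  have : {q : G K × G K | (QuotientGroup.mk q.1 : Space K) = QuotientGroup.mk q.2} =
      (fun q : G K × G K => q.1⁻¹ * q.2) ⁻¹' (Gam K : Set (G K)) := by
    ext q
    exact QuotientGroup.eq
  rw [this]
  exact isClosed_Gam.preimage (by fun_prop)

instance (H : Subgroup (G K)) : ContinuousSMul H (Space K) where
  continuous_smul := by
    have h : Continuous fun p : H × Space K => (p.1 : G K) • p.2 := by fun_prop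
    exact h

/-! ### Elements of the diagonal torus -/

section Component

variable {A : Type*} [TopologicalSpace A] [Group A] [IsTopologicalGroup A]

lemma identityComponent_le (H : Subgroup A) : identityComponent H ≤ H := by
  rintro _ ⟨x, -, rfl⟩
  exact x.2

lemma isClosed_identityComponent {H : Subgroup A} (hH : IsClosed (H : Set A)) :
    IsClosed (identityComponent H : Set A) := by
  have h : (identityComponent H : Set A) = Subtype.val '' connectedComponent (1 : H) := rfl
  rw [h]
  exact (hH.isClosedEmbedding_subtypeVal).isClosedMap _ isClosed_connectedComponent

lemma mem_identityComponent {E : Type*} [TopologicalSpace E] [PreconnectedSpace E]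
    {H : Subgroup A} {f : E → A} (hf : Continuous f) (hH : ∀ e, f e ∈ H) {e₀ : E}
    (h₀ : f e₀ = 1) (e : E) : f e ∈ identityComponent H := by
  have hc : Continuous fun e => (⟨f e, hH e⟩ : H) := hf.subtype_mk _
  refine ⟨⟨f e, hH e⟩, ?_, rfl⟩
  have := (isPreconnected_range hc).subset_connectedComponent (x := (1 : H))
    ⟨e₀, Subtype.ext h₀⟩
  exact this ⟨e, rfl⟩

end Component

/-- The diagonal matrix in `SL(2, L)` with entry `x` in row `j` and `x⁻¹` in the other row. -/
def diagSL {L : Type*} [Field L] (j : Fin 2) (x : Lˣ) : SL(2, L) :=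
  ⟨Matrix.diagonal fun i => if i = j then (x : L) else (x : L)⁻¹, by
    fin_cases j <;> simp⟩

section diagSL

variable {L : Type*} [Field L]

lemma diagSL_apply (j : Fin 2) (x : Lˣ) (a b : Fin 2) :
    diagSL j x a b = if a = b then (if a = j then (x : L) else (x : L)⁻¹) else 0 := by
  simp only [diagSL, Matrix.SpecialLinearGroup.coe_mk, Matrix.diagonal_apply]

@[simp] lemma diagSL_self (j : Fin 2) (x : Lˣ) : diagSL j x j j = x := by
  simp [diagSL_apply]

@[simp] lemma diagSL_other (j : Fin 2) (x : Lˣ) : diagSL j x (1 - j) (1 - j) = (x : L)⁻¹ := by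
  rw [diagSL_apply, if_pos rfl, if_neg (by revert j; decide)]

lemma diagSL_one (j : Fin 2) : diagSL j (1 : Lˣ) = 1 := by
  ext a b
  rw [diagSL_apply, Matrix.SpecialLinearGroup.coe_one, Matrix.one_apply]
  simp

lemma diagSL_mem (j : Fin 2) (x : Lˣ) : diagSL j x ∈ diagonalSubgroup L := by
  constructor <;> simp [diagSL_apply]

lemma mem_diagonalSubgroup_apply {A : SL(2, L)} (hA : A ∈ diagonalSubgroup L) {a b : Fin 2}
    (h : a ≠ b) : A a b = 0 := by
  obtain ⟨h1, h2⟩ := hA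
  fin_cases a <;> fin_cases b <;> simp_all

lemma diagonal_mul_diagonal {A : SL(2, L)} (hA : A ∈ diagonalSubgroup L) (j : Fin 2) :
    A j j * A (1 - j) (1 - j) = 1 := by
  have h := A.det_coe
  obtain ⟨h1, h2⟩ := hA
  rw [Matrix.det_fin_two, h1] at h
  fin_cases j <;> simp <;> linear_combination h

lemma continuous_diagSL [TopologicalSpace L] [IsTopologicalDivisionRing L]
    {E : Type*} [TopologicalSpace E] (j : Fin 2) {f : E → Lˣ}
    (hf : Continuous fun e => (f e : L)) : Continuous fun e => diagSL j (f e) := by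
  refine continuous_induced_rng.2 ?_
  refine Continuous.matrix_diagonal (continuous_pi fun i => ?_)
  split_ifs
  · exact hf
  · exact hf.inv₀ fun e => (f e).ne_zero

end diagSL

lemma isClosed_diagonalSubgroup (v : InfinitePlace K) :
    IsClosed (diagonalSubgroup v.Completion : Set SL(2, v.Completion)) := by
  have h : ∀ i j, Continuous fun A : SL(2, v.Completion) => A i j := fun i j =>
    (continuous_apply j).comp ((continuous_apply i).comp
      (continuous_subtype_val : Continuous fun A : SL(2, v.Completion) => A.1))
  exact (isClosed_eq (h 0 1) continuous_const).inter (isClosed_eq (h 1 0) continuous_const)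

lemma isClosed_torusAt (v : InfinitePlace K) :
    IsClosed (torusAt v : Set SL(2, v.Completion)) :=
  isClosed_identityComponent (isClosed_diagonalSubgroup v)

lemma torusAt_le (v : InfinitePlace K) : torusAt v ≤ diagonalSubgroup v.Completion :=
  identityComponent_le _

lemma isClosed_D : IsClosed (D K : Set (G K)) := by
  have : (D K : Set (G K)) = Set.univ.pi fun v => (torusAt v : Set SL(2, v.Completion)) := rfl
  rw [this]
  exact isClosed_set_pi fun v _ => isClosed_torusAt v

lemma diagSL_mem_torusAt {v : InfinitePlace K} {E : Type*} [TopologicalSpace E]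
    [PreconnectedSpace E] (j : Fin 2) {f : E → v.Completionˣ}
    (hf : Continuous fun e => (f e : v.Completion)) {e₀ : E} (h₀ : f e₀ = 1) (e : E) :
    diagSL j (f e) ∈ torusAt v :=
  mem_identityComponent (continuous_diagSL j hf) (fun e => diagSL_mem j (f e))
    (e₀ := e₀) (by rw [h₀, diagSL_one]) e

/-- The torus contains the squares: in `ℝ` they are positive, and `ℂˣ` is connected. -/
lemma diagSL_sq_mem_torusAt (v : InfinitePlace K) (j : Fin 2) (x : v.Completionˣ) :
    diagSL j (x ^ 2) ∈ torusAt v := by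
  by_cases hv : v.IsReal
  · let e := InfinitePlace.Completion.ringEquivRealOfIsReal hv
    have hec : Continuous e.symm :=
      (InfinitePlace.Completion.isometryEquivRealOfIsReal hv).symm.continuous
    let f : ℝ → v.Completionˣ := fun s => Units.mk0 (e.symm (Real.exp s)) (by
      simp [Real.exp_ne_zero])
    have hx : e (x : v.Completion) ≠ 0 := by simp
    have h := diagSL_mem_torusAt (v := v) j (f := f) (e₀ := 0)
      (hec.comp Real.continuous_exp) (by ext1; simp [f]) (Real.log ((e x) ^ 2))
    convert! h using 2
    ext1
    simp only [f, Units.val_mk0, Units.val_pow_eq_pow_val]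
    rw [Real.exp_log (by positivity), map_pow, RingEquiv.symm_apply_apply]
  · have hv' := InfinitePlace.not_isReal_iff_isComplex.1 hv
    let e := InfinitePlace.Completion.ringEquivComplexOfIsComplex hv'
    have hec : Continuous e.symm :=
      (InfinitePlace.Completion.isometryEquivComplexOfIsComplex hv').symm.continuous
    let f : ℂ → v.Completionˣ := fun s => Units.mk0 (e.symm (Complex.exp s)) (by
      simp [Complex.exp_ne_zero])
    have hx : e (x : v.Completion) ≠ 0 := by simp
    have h := diagSL_mem_torusAt (v := v) j (f := f) (e₀ := 0)
      (hec.comp Complex.continuous_exp) (by ext1; simp [f]) (Complex.log ((e x) ^ 2))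
    convert! h using 2
    ext1
    simp only [f, Units.val_mk0, Units.val_pow_eq_pow_val]
    rw [Complex.exp_log (by positivity), map_pow, RingEquiv.symm_apply_apply]

lemma exists_realLift (v : InfinitePlace K) : ∃ φ : ℝ →+* v.Completion,
    ∀ r, InfinitePlace.Completion.extensionEmbedding v (φ r) = r := by
  by_cases hv : v.IsReal
  · refine ⟨(InfinitePlace.Completion.ringEquivRealOfIsReal hv).symm.toRingHom, fun r => ?_⟩
    rw [← InfinitePlace.Completion.extensionEmbeddingOfIsReal_apply hv,
      ← InfinitePlace.Completion.ringEquivRealOfIsReal_apply]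
    simp
  · have hv' := InfinitePlace.not_isReal_iff_isComplex.1 hv
    refine ⟨(InfinitePlace.Completion.ringEquivComplexOfIsComplex hv').symm.toRingHom.comp
      Complex.ofRealHom, fun r => ?_⟩
    rw [← InfinitePlace.Completion.ringEquivComplexOfIsComplex_apply hv']
    simp

/-- The embedding of `ℝ` in the completion `K_v`. -/
noncomputable def realLift (v : InfinitePlace K) : ℝ →+* v.Completion :=
  (exists_realLift v).choose

lemma extensionEmbedding_realLift (v : InfinitePlace K) (r : ℝ) :
    InfinitePlace.Completion.extensionEmbedding v (realLift v r) = r :=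
  (exists_realLift v).choose_spec r

lemma continuous_realLift (v : InfinitePlace K) : Continuous (realLift v) := by
  rw [(isClosedEmbedding_extensionEmbedding v).isEmbedding.continuous_iff]
  have : InfinitePlace.Completion.extensionEmbedding v ∘ realLift v = fun r : ℝ => (r : ℂ) :=
    funext (extensionEmbedding_realLift v)
  rw [this]
  exact Complex.continuous_ofReal

lemma norm_realLift (v : InfinitePlace K) (r : ℝ) : ‖realLift v r‖ = |r| := by
  rw [← (InfinitePlace.Completion.isometry_extensionEmbedding v).norm_map_of_map_zero
    (map_zero _), extensionEmbedding_realLift]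
  simp

/-- The real number `e ^ t` as a unit of the completion `K_v`. -/
noncomputable def expAt (v : InfinitePlace K) (t : ℝ) : v.Completionˣ :=
  Units.mk0 (realLift v (Real.exp t)) (by simp [Real.exp_ne_zero])

lemma norm_expAt (v : InfinitePlace K) (t : ℝ) : ‖(expAt v t : v.Completion)‖ = Real.exp t := by
  simp [expAt, norm_realLift]

lemma continuous_expAt (v : InfinitePlace K) :
    Continuous fun t => (expAt v t : v.Completion) :=
  (continuous_realLift v).comp Real.continuous_exp

lemma expAt_zero (v : InfinitePlace K) : expAt v 0 = 1 := by
  ext1; simp [expAt]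

lemma diagSL_expAt_mem_torusAt (v : InfinitePlace K) (j : Fin 2) (t : ℝ) :
    diagSL j (expAt v t) ∈ torusAt v :=
  diagSL_mem_torusAt j (continuous_expAt v) (expAt_zero v) t

lemma diagSL_expAt_mem_realTorusAt (v : InfinitePlace K) (j : Fin 2) (t : ℝ) :
    diagSL j (expAt v t) ∈ realTorusAt v := by
  refine mem_identityComponent (f := fun t => diagSL j (expAt v t)) (e₀ := (0 : ℝ))
    (continuous_diagSL j (continuous_expAt v)) (fun s => ?_) ?_ t
  · refine ⟨diagSL_expAt_mem_torusAt v j s, ?_⟩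
    refine ⟨diagSL j (Units.mk0 (Real.exp s) (Real.exp_ne_zero s)), ?_⟩
    ext a b
    simp only [Matrix.SpecialLinearGroup.map_apply_coe, RingHom.mapMatrix_apply,
      Matrix.map_apply, diagSL_apply, expAt, Units.val_mk0]
    split_ifs <;> simp [extensionEmbedding_realLift]
  · simp only [expAt_zero, diagSL_one]

/-! ### Vectors and the linear forms given by the rows -/

/-- The vector `g k`: its coordinate at the place `v` in row `j` is the value on `k ∈ 𝓞²` of the
linear form given by row `j` of `g_v`. -/
noncomputable def act (g : G K) (k : Fin 2 → 𝓞 K) (v : InfinitePlace K) (j : Fin 2) :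
    v.Completion :=
  g v j 0 * emb v (k 0) + g v j 1 * emb v (k 1)

lemma act_mul (h g : G K) (k : Fin 2 → 𝓞 K) (v : InfinitePlace K) (j : Fin 2) :
    act (h * g) k v j = h v j 0 * act g k v 0 + h v j 1 * act g k v 1 := by
  simp only [act, Pi.mul_apply, Matrix.SpecialLinearGroup.coe_mul, Matrix.mul_apply,
    Fin.sum_univ_two]
  ring

lemma act_mul_diagonalEmbedding (g : G K) (γ : SL(2, 𝓞 K)) (k : Fin 2 → 𝓞 K)
    (v : InfinitePlace K) (j : Fin 2) :
    act (g * diagonalEmbedding K γ) k v j = act g (γ.1.mulVec k) v j := by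
  simp only [act, Pi.mul_apply, Matrix.SpecialLinearGroup.coe_mul, Matrix.mul_apply,
    Fin.sum_univ_two, diagonalEmbedding_apply, Matrix.mulVec, dotProduct, map_add, map_mul]
  ring

lemma act_smul (g : G K) (c : 𝓞 K) (k : Fin 2 → 𝓞 K) (v : InfinitePlace K) (j : Fin 2) :
    act g (c • k) v j = emb v c * act g k v j := by
  simp only [act, Pi.smul_apply, smul_eq_mul, map_mul]
  ring

lemma act_sub (g : G K) (k l : Fin 2 → 𝓞 K) (v : InfinitePlace K) (j : Fin 2) :
    act g (k - l) v j = act g k v j - act g l v j := by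
  simp only [act, Pi.sub_apply, map_sub]
  ring

lemma det_entries (g : G K) (v : InfinitePlace K) :
    g v 0 0 * g v 1 1 - g v 0 1 * g v 1 0 = 1 := by
  have := (g v).det_coe
  rwa [Matrix.det_fin_two] at this

lemma emb_zero_eq (g : G K) (k : Fin 2 → 𝓞 K) (v : InfinitePlace K) :
    emb v (k 0) = g v 1 1 * act g k v 0 - g v 0 1 * act g k v 1 := by
  simp only [act]
  linear_combination -(emb v (k 0)) * det_entries g v

lemma emb_one_eq (g : G K) (k : Fin 2 → 𝓞 K) (v : InfinitePlace K) :
    emb v (k 1) = g v 0 0 * act g k v 1 - g v 1 0 * act g k v 0 := by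
  simp only [act]
  linear_combination -(emb v (k 1)) * det_entries g v

lemma act_det (g : G K) (k l : Fin 2 → 𝓞 K) (v : InfinitePlace K) :
    act g k v 0 * act g l v 1 - act g k v 1 * act g l v 0 = emb v (k 0 * l 1 - k 1 * l 0) := by
  simp only [act, map_sub, map_mul]
  linear_combination
    (emb v (k 0) * emb v (l 1) - emb v (k 1) * emb v (l 0)) * det_entries g v

lemma ne_zero_iff_entry {k : Fin 2 → 𝓞 K} : k ≠ 0 ↔ ∃ i, k i ≠ 0 := Function.ne_iff

lemma act_ne_zero {g : G K} {k : Fin 2 → 𝓞 K} (hk : k ≠ 0) {v : InfinitePlace K} {j : Fin 2}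
    (h : act g k v j = 0) : act g k v (1 - j) ≠ 0 := by
  intro h'
  have h0 : act g k v 0 = 0 := by fin_cases j <;> simp_all
  have h1 : act g k v 1 = 0 := by fin_cases j <;> simp_all
  obtain ⟨i, hi⟩ := ne_zero_iff_entry.1 hk
  refine emb_ne_zero v hi ?_
  fin_cases i
  · simpa [h0, h1] using emb_zero_eq g k v
  · simpa [h0, h1] using emb_one_eq g k v

lemma exists_act_ne_zero (g : G K) {k : Fin 2 → 𝓞 K} (hk : k ≠ 0) (v : InfinitePlace K) :
    ∃ j, act g k v j ≠ 0 := by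
  by_contra! h
  exact act_ne_zero hk (h 0) (h _)

/-- A row that kills a nonzero vector kills every vector proportional to it. -/
lemma kill_of_parallel {g : G K} {k l : Fin 2 → 𝓞 K} (hk0 : k ≠ 0)
    (hkl : k 0 * l 1 = k 1 * l 0) {v : InfinitePlace K} {j : Fin 2}
    (hk : act g k v j = 0) : act g l v j = 0 := by
  obtain ⟨i, hi⟩ := ne_zero_iff_entry.1 hk0
  have h : k i • l = l i • k := by
    funext a
    fin_cases i <;> fin_cases a <;> simp only [Fin.zero_eta, Fin.mk_one, Pi.smul_apply,
      smul_eq_mul] <;> first | ring1 | linear_combination hkl | linear_combination -hkl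
  have h2 : emb v (k i) * act g l v j = 0 := by
    rw [← act_smul, h, act_smul, hk, mul_zero]
  exact (mul_eq_zero.1 h2).resolve_left (emb_ne_zero v hi)

/-! ### Diagonal elements -/

lemma mem_D_iff {d : G K} : d ∈ D K ↔ ∀ v, d v ∈ torusAt v := by
  simp [D, Subgroup.mem_pi]

lemma D_offdiag {d : G K} (hd : d ∈ D K) (v : InfinitePlace K) {a b : Fin 2} (h : a ≠ b) :
    d v a b = 0 :=
  mem_diagonalSubgroup_apply (torusAt_le v (mem_D_iff.1 hd v)) h

lemma D_mul_other {d : G K} (hd : d ∈ D K) (v : InfinitePlace K) (j : Fin 2) :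
    d v j j * d v (1 - j) (1 - j) = 1 :=
  diagonal_mul_diagonal (torusAt_le v (mem_D_iff.1 hd v)) j

lemma D_ne_zero {d : G K} (hd : d ∈ D K) (v : InfinitePlace K) (j : Fin 2) : d v j j ≠ 0 :=
  left_ne_zero_of_mul_eq_one (D_mul_other hd v j)

lemma act_diag_mul {d : G K} (hd : d ∈ D K) (g : G K) (k : Fin 2 → 𝓞 K) (v : InfinitePlace K)
    (j : Fin 2) : act (d * g) k v j = d v j j * act g k v j := by
  rw [act_mul]
  fin_cases j
  · simp [D_offdiag hd v (show (0 : Fin 2) ≠ 1 by decide)]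
  · simp [D_offdiag hd v (show (1 : Fin 2) ≠ 0 by decide)]

/-- The logarithmic size of the entry of `d_v` in row `j`. -/
noncomputable def logEntry (d : G K) (v : InfinitePlace K) (j : Fin 2) : ℝ :=
  Real.log ‖d v j j‖

lemma norm_entry_eq_exp {d : G K} (hd : d ∈ D K) (v : InfinitePlace K) (j : Fin 2) :
    ‖d v j j‖ = Real.exp (logEntry d v j) :=
  (Real.exp_log (norm_pos_iff.2 (D_ne_zero hd v j))).symm

lemma logEntry_other {d : G K} (hd : d ∈ D K) (v : InfinitePlace K) (j : Fin 2) :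
    logEntry d v (1 - j) = -logEntry d v j := by
  have h := congrArg (fun x => Real.log ‖x‖) (D_mul_other hd v j)
  simp only [norm_mul, norm_one, Real.log_one] at h
  rw [Real.log_mul (norm_ne_zero_iff.2 (D_ne_zero hd v _))
    (norm_ne_zero_iff.2 (D_ne_zero hd v _))] at h
  unfold logEntry
  linarith

lemma abs_logEntry {d : G K} (hd : d ∈ D K) (v : InfinitePlace K) (i j : Fin 2) :
    |logEntry d v i| = |logEntry d v j| := by
  by_cases h : i = j
  · rw [h]
  · rw [show i = 1 - j by revert h; revert i j; decide, logEntry_other hd, abs_neg]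

lemma D_mul_entry {d e : G K} (hd : d ∈ D K) (v : InfinitePlace K) (j : Fin 2) :
    (d * e) v j j = d v j j * e v j j := by
  simp only [Pi.mul_apply, Matrix.SpecialLinearGroup.coe_mul, Matrix.mul_apply, Fin.sum_univ_two]
  fin_cases j
  · simp [D_offdiag hd v (show (0 : Fin 2) ≠ 1 by decide)]
  · simp [D_offdiag hd v (show (1 : Fin 2) ≠ 0 by decide)]

lemma logEntry_mul {d e : G K} (hd : d ∈ D K) (he : e ∈ D K) (v : InfinitePlace K)
    (j : Fin 2) : logEntry (d * e) v j = logEntry d v j + logEntry e v j := by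
  unfold logEntry
  rw [D_mul_entry hd, norm_mul, Real.log_mul (norm_ne_zero_iff.2 (D_ne_zero hd v _))
    (norm_ne_zero_iff.2 (D_ne_zero he v _))]

lemma logEntry_one (v : InfinitePlace K) (j : Fin 2) : logEntry (1 : G K) v j = 0 := by
  simp [logEntry]

lemma logEntry_inv {d : G K} (hd : d ∈ D K) (v : InfinitePlace K) (j : Fin 2) :
    logEntry d⁻¹ v j = -logEntry d v j := by
  have := logEntry_mul hd (inv_mem hd) v j
  rw [mul_inv_cancel, logEntry_one] at this
  linarith

lemma logEntry_pow {d : G K} (hd : d ∈ D K) (v : InfinitePlace K) (j : Fin 2) (n : ℕ) :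
    logEntry (d ^ n) v j = n * logEntry d v j := by
  induction n with
  | zero => simp [logEntry_one]
  | succ n ih =>
    rw [pow_succ, logEntry_mul (pow_mem hd n) hd, ih]
    push_cast
    ring

lemma logEntry_zpow {d : G K} (hd : d ∈ D K) (v : InfinitePlace K) (j : Fin 2) (n : ℤ) :
    logEntry (d ^ n) v j = n * logEntry d v j := by
  obtain ⟨n, rfl | rfl⟩ := n.eq_nat_or_neg
  · simpa using logEntry_pow hd v j n
  · rw [zpow_neg, logEntry_inv (zpow_mem hd _), zpow_natCast, logEntry_pow hd]
    push_cast
    ring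

lemma smul_proj (d g : G K) : d • proj K g = proj K (d * g) := rfl

lemma D_smul_proj (d : D K) (g : G K) : d • proj K g = proj K (d * g) := rfl

/-! ### Heights -/

/-- Mahler's principle, easy half: if `z` has bounded entries, no nonzero vector `z w`,
`w ∈ 𝓞²`, is short in the sense of the product of its normalized local norms. -/
lemma one_le_prod_of_entries_lt {B : ℝ} {z : G K} (hz : ∀ v i j, ‖z v i j‖ < B)
    {w : Fin 2 → 𝓞 K} (hw : w ≠ 0) {s : InfinitePlace K → ℝ}
    (hs : ∀ v j, ‖act z w v j‖ ≤ s v) :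
    1 ≤ ∏ v : InfinitePlace K, (2 * B * s v) ^ v.mult := by
  obtain ⟨i, hi⟩ := ne_zero_iff_entry.1 hw
  refine (one_le_prod_norm_emb hi).trans (Finset.prod_le_prod (fun _ _ => by positivity) ?_)
  intro v _
  refine pow_le_pow_left₀ (norm_nonneg _) ?_ _
  have key : ∀ a b c d : v.Completion, ‖a‖ < B → ‖c‖ < B → ‖b‖ ≤ s v → ‖d‖ ≤ s v →
      ‖a * b - c * d‖ ≤ 2 * B * s v := by
    intro a b c d ha hc hb hd
    have h1 : ‖a * b‖ ≤ B * s v := by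
      rw [norm_mul]; exact mul_le_mul ha.le hb (norm_nonneg _) ((norm_nonneg _).trans ha.le)
    have h2 : ‖c * d‖ ≤ B * s v := by
      rw [norm_mul]; exact mul_le_mul hc.le hd (norm_nonneg _) ((norm_nonneg _).trans hc.le)
    linarith [norm_sub_le (a * b) (c * d)]
  fin_cases i
  · simp only [Fin.zero_eta, emb_zero_eq z w v]
    exact key _ _ _ _ (hz _ _ _) (hz _ _ _) (hs _ _) (hs _ _)
  · simp only [Fin.mk_one, emb_one_eq z w v]
    exact key _ _ _ _ (hz _ _ _) (hz _ _ _) (hs _ _) (hs _ _)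

lemma exists_eq_mul_of_proj_eq {a b : G K} (h : proj K a = proj K b) :
    ∃ γ : SL(2, 𝓞 K), b = a * diagonalEmbedding K γ := by
  obtain ⟨γ, hγ⟩ := proj_eq_iff.1 h
  exact ⟨γ, by rw [hγ]; group⟩

lemma mulVec_ne_zero (γ : SL(2, 𝓞 K)) {k : Fin 2 → 𝓞 K} (hk : k ≠ 0) : γ.1.mulVec k ≠ 0 := by
  intro h
  apply hk
  have := congrArg (γ⁻¹).1.mulVec h
  rwa [Matrix.mulVec_mulVec, ← Matrix.SpecialLinearGroup.coe_mul, inv_mul_cancel,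
    Matrix.SpecialLinearGroup.coe_one, Matrix.one_mulVec, Matrix.mulVec_zero] at this

/-- If translates `u_i π(g)` converge, then the height of the vectors `u_i g k` stays bounded away
from zero. The logarithmic contribution of the place `v` to the height of `u_i g k` is, up to a
constant, the largest `logEntry (u i) v j` over the rows `j` of `g_v` that do not kill `k`. -/
lemma exists_height_bound {ι : Type*} {l : Filter ι} {u : ι → D K} {g : G K} {x : Space K}
    (hx : Tendsto (fun i => u i • proj K g) l (𝓝 x)) {k : Fin 2 → 𝓞 K} (hk : k ≠ 0) :
    ∃ C : ℝ, ∀ᶠ i in l, ∀ r : InfinitePlace K → ℝ,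
      (∀ v j, act g k v j ≠ 0 → logEntry (u i) v j ≤ r v) → -C ≤ ∑ v, v.mult * r v := by
  obtain ⟨y, rfl⟩ := QuotientGroup.mk_surjective x
  obtain ⟨B, hB0, hB⟩ := exists_entries_lt y
  obtain ⟨M, hM0, hM⟩ : ∃ M : ℝ, 0 < M ∧ ∀ v j, ‖act g k v j‖ ≤ M := by
    refine ⟨1 + ∑ v, ∑ j, ‖act g k v j‖, by positivity, fun v j => ?_⟩
    have h1 := Finset.single_le_sum (f := fun j => ‖act g k v j‖) (fun _ _ => norm_nonneg _)
      (Finset.mem_univ j)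
    have h2 := Finset.single_le_sum (f := fun v => ∑ j, ‖act g k v j‖)
      (fun _ _ => by positivity) (Finset.mem_univ v)
    linarith
  refine ⟨∑ v : InfinitePlace K, v.mult * Real.log (2 * B * M), ?_⟩
  have hnhds : (QuotientGroup.mk '' {z : G K | ∀ v i j, ‖z v i j‖ < B} : Set (Space K)) ∈
      𝓝 (QuotientGroup.mk y : Space K) :=
    ((QuotientGroup.isOpenQuotientMap_mk.isOpenMap _ (isOpen_entries_lt B)).mem_nhds ⟨y, hB, rfl⟩)
  filter_upwards [hx hnhds] with i hi r hr
  obtain ⟨z, hz, hzi⟩ := hi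
  obtain ⟨γ, hγ⟩ := exists_eq_mul_of_proj_eq (b := (u i : G K) * g) hzi
  have h1 : ∀ v j, ‖act z (γ.1.mulVec k) v j‖ ≤ Real.exp (r v) * M := by
    intro v j
    rw [← act_mul_diagonalEmbedding, ← hγ, act_diag_mul (u i).2, norm_mul,
      norm_entry_eq_exp (u i).2]
    by_cases h0 : act g k v j = 0
    · rw [h0, norm_zero, mul_zero]; positivity
    · exact mul_le_mul (Real.exp_le_exp.2 (hr v j h0)) (hM v j) (norm_nonneg _)
        (Real.exp_pos _).le
  have h2 := one_le_prod_of_entries_lt hz (mulVec_ne_zero γ hk) h1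
  have h3 := Real.log_nonneg h2
  rw [Real.log_prod (fun v _ => by positivity)] at h3
  have h4 : ∀ v : InfinitePlace K, Real.log ((2 * B * (Real.exp (r v) * M)) ^ v.mult) =
      v.mult * Real.log (2 * B * M) + v.mult * r v := by
    intro v
    rw [Real.log_pow, show 2 * B * (Real.exp (r v) * M) = (2 * B * M) * Real.exp (r v) by ring,
      Real.log_mul (by positivity) (by positivity), Real.log_exp]
    ring
  rw [Finset.sum_congr rfl fun v _ => h4 v, Finset.sum_add_distrib] at h3
  linarith

/-- The elements of `D` of bounded logarithmic size form a compact set. -/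
lemma isCompact_logEntry_le (B : ℝ) : IsCompact {d : D K | ∀ v, |logEntry (d : G K) v 0| ≤ B} := by
  have h := (isClosed_D (K := K)).isClosedEmbedding_subtypeVal.isCompact_preimage
    (isCompact_entries_le (Real.exp B))
  refine Eq.mp (congrArg IsCompact (Set.ext fun d => ?_)) h
  simp only [Set.mem_preimage, Set.mem_ofPred_eq]
  constructor
  · intro hd v
    have h0 := hd v 0 0
    have h1 := hd v 1 1
    rw [norm_entry_eq_exp d.2, Real.exp_le_exp] at h0 h1
    have := logEntry_other d.2 v 0
    rw [sub_zero] at this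
    exact abs_le.2 ⟨by linarith, h0⟩
  · intro hd v i j
    by_cases hij : i = j
    · subst hij
      rw [norm_entry_eq_exp d.2, Real.exp_le_exp]
      exact (le_abs_self _).trans ((abs_logEntry d.2 v i 0).trans_le (hd v))
    · rw [D_offdiag d.2 v hij, norm_zero]
      positivity

/-- Limits of bounded translates stay in the orbit. -/
lemma mem_orbit_of_bounded {ι : Type*} {l : Filter ι} [l.NeBot] {u : ι → D K} {p x : Space K}
    (hx : Tendsto (fun i => u i • p) l (𝓝 x)) {B : ℝ} {j : InfinitePlace K → Fin 2}
    (hB : ∀ᶠ i in l, ∀ v, |logEntry (u i) v (j v)| ≤ B) : x ∈ orbitD p := by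
  have hB' : ∀ᶠ i in l, u i ∈ {d : D K | ∀ v, |logEntry (d : G K) v 0| ≤ B} := by
    filter_upwards [hB] with i hi v
    exact (abs_logEntry (u i).2 v 0 (j v)).trans_le (hi v)
  have himg : IsCompact ((fun d : D K => d • p) '' {d : D K | ∀ v, |logEntry (d : G K) v 0| ≤ B}) :=
    (isCompact_logEntry_le B).image (by fun_prop)
  obtain ⟨d, -, hd⟩ := himg.isClosed.mem_of_tendsto hx
    (hB'.mono fun i hi => Set.mem_image_of_mem _ hi)
  exact ⟨d, hd⟩

lemma exists_ultrafilter_of_mem_closure {p x : Space K} (hx : x ∈ closure (orbitD p)) :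
    ∃ l : Ultrafilter (D K), Tendsto (fun d : D K => d • p) l (𝓝 x) := by
  have h : (comap (fun d : D K => d • p) (𝓝 x)).NeBot := by
    rw [comap_neBot_iff]
    intro t ht
    obtain ⟨y, hy, d, rfl⟩ := mem_closure_iff_nhds.1 hx t ht
    exact ⟨d, hy⟩
  refine ⟨Ultrafilter.of _, (tendsto_comap.mono_left (Ultrafilter.of_le _))⟩

/-! ### Closed orbits -/

lemma eq_other {i j : Fin 2} (h : j ≠ i) : j = 1 - i := by
  revert i j; decide

/-- The element `g` is matched: two lines of `K²`, spanned by `a` and `b`, are the kernels of the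
rows of every `g_v`, the row killing `a` being `σ v`. Equivalently, `g` lies in the product of the
normalizer of the full diagonal group with `SL(2, K)`. -/
def Matched (g : G K) (a b : Fin 2 → 𝓞 K) (σ : InfinitePlace K → Fin 2) : Prop :=
  a ≠ 0 ∧ b ≠ 0 ∧ ∀ v, act g a v (σ v) = 0 ∧ act g b v (1 - σ v) = 0

lemma Matched.det_ne_zero {g : G K} {a b : Fin 2 → 𝓞 K} {σ : InfinitePlace K → Fin 2}
    (h : Matched g a b σ) : a 0 * b 1 - a 1 * b 0 ≠ 0 := by
  obtain ⟨ha, hb, hσ⟩ := h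
  intro h0
  obtain ⟨v⟩ : Nonempty (InfinitePlace K) := inferInstance
  refine act_ne_zero hb (kill_of_parallel ha (sub_eq_zero.1 h0) (hσ v).1) (hσ v).2

lemma ext_of_act {g h : G K} {a b : Fin 2 → 𝓞 K} (hab : a 0 * b 1 - a 1 * b 0 ≠ 0)
    (ha : ∀ v j, act g a v j = act h a v j) (hb : ∀ v j, act g b v j = act h b v j) : g = h := by
  funext v
  have hδ := emb_ne_zero v hab
  refine Matrix.SpecialLinearGroup.ext _ _ fun i j => ?_
  have h1 := ha v i
  have h2 := hb v i
  simp only [act] at h1 h2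
  simp only [map_sub, map_mul] at hδ
  refine mul_right_cancel₀ hδ ?_
  fin_cases j
  · simp only [Fin.zero_eta]
    linear_combination emb v (b 1) * h1 - emb v (a 1) * h2
  · simp only [Fin.mk_one]
    linear_combination emb v (a 0) * h2 - emb v (b 0) * h1

/-- A unit congruent to `1` modulo `det (a, b)` is an eigenvalue of an element of `SL(2, 𝓞)` with
eigenvectors `a` and `b`. -/
lemma exists_SL_eigen {a b : Fin 2 → 𝓞 K} {u : (𝓞 K)ˣ}
    (hu : a 0 * b 1 - a 1 * b 0 ∣ (u : 𝓞 K) - 1) :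
    ∃ γ : SL(2, 𝓞 K), γ.1.mulVec a = (u : 𝓞 K) • a ∧
      γ.1.mulVec b = ((u⁻¹ : (𝓞 K)ˣ) : 𝓞 K) • b := by
  obtain ⟨w, hw⟩ := hu
  have huu : (u : 𝓞 K) * ((u⁻¹ : (𝓞 K)ˣ) : 𝓞 K) = 1 := u.mul_inv
  set U : 𝓞 K := (u : 𝓞 K)
  set V : 𝓞 K := ((u⁻¹ : (𝓞 K)ˣ) : 𝓞 K)
  have hw' : V - 1 = (a 0 * b 1 - a 1 * b 0) * (-(V * w)) := by
    linear_combination -V * hw + huu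
  generalize hx : -(V * w) = x at hw'
  have hU : U = 1 + (a 0 * b 1 - a 1 * b 0) * w := by linear_combination hw
  have hV : V = 1 + (a 0 * b 1 - a 1 * b 0) * x := by linear_combination hw'
  refine ⟨⟨!![1 + w * (a 0 * b 1) - x * (b 0 * a 1), -(w * (a 0 * b 0)) + x * (b 0 * a 0);
    w * (a 1 * b 1) - x * (b 1 * a 1), 1 - w * (a 1 * b 0) + x * (b 1 * a 0)], ?_⟩, ?_, ?_⟩
  · rw [Matrix.det_fin_two_of]
    rw [hU, hV] at huu
    linear_combination huu
  · funext i
    fin_cases i <;> simp [Matrix.mulVec, dotProduct, Fin.sum_univ_two, hU] <;> ring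
  · funext i
    fin_cases i <;> simp [Matrix.mulVec, dotProduct, Fin.sum_univ_two, hV] <;> ring

lemma exists_pow_congr_one {δ : 𝓞 K} (hδ : δ ≠ 0) (u : (𝓞 K)ˣ) :
    ∃ n : ℕ, 0 < n ∧ δ ∣ ((u ^ n : (𝓞 K)ˣ) : 𝓞 K) - 1 := by
  have hfin : Finite (𝓞 K ⧸ Ideal.span {δ}) :=
    Ideal.finiteQuotientOfFreeOfNeBot _ (by simpa using hδ)
  let φ : (𝓞 K)ˣ →* (𝓞 K ⧸ Ideal.span {δ})ˣ := Units.map (Ideal.Quotient.mk _).toMonoidHom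
  obtain ⟨n, hn, hpow⟩ := isOfFinOrder_iff_pow_eq_one.1 (isOfFinOrder_of_finite (φ u))
  refine ⟨n, hn, ?_⟩
  rw [← Ideal.mem_span_singleton, ← Ideal.Quotient.eq]
  have := congrArg Units.val hpow
  rw [← map_pow] at this
  simpa [φ] using this

lemma sum_places {v₁ v₂ : InfinitePlace K} (hne : v₁ ≠ v₂) (hall : ∀ v, v = v₁ ∨ v = v₂)
    (f : InfinitePlace K → ℝ) : ∑ v, f v = f v₁ + f v₂ :=
  Fintype.sum_eq_add v₁ v₂ hne fun v hv => ((hall v).elim hv.1 hv.2).elim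

lemma exists_places (hr : Fintype.card (InfinitePlace K) = 2) :
    ∃ v₁ v₂ : InfinitePlace K, v₁ ≠ v₂ ∧ ∀ v, v = v₁ ∨ v = v₂ := by
  classical
  rw [← Finset.card_univ, Finset.card_eq_two] at hr
  obtain ⟨v₁, v₂, hne, h⟩ := hr
  refine ⟨v₁, v₂, hne, fun v => ?_⟩
  have := h ▸ Finset.mem_univ v
  simpa using this

lemma mult_cast_pos (v : InfinitePlace K) : (0 : ℝ) < v.mult := by exact_mod_cast v.mult_pos

/-- The stabilizer of a matched point in `D` contains hyperbolic elements coming from units. -/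
lemma Matched.exists_stabilizer {g : G K} {a b : Fin 2 → 𝓞 K} {σ : InfinitePlace K → Fin 2}
    (h : Matched g a b σ) {v₁ v₂ : InfinitePlace K} (hne : v₁ ≠ v₂)
    (hall : ∀ v, v = v₁ ∨ v = v₂) :
    ∃ s : D K, s • proj K g = proj K g ∧ 0 < logEntry (s : G K) v₁ (1 - σ v₁) ∧
      v₁.mult * logEntry (s : G K) v₁ (1 - σ v₁) +
        v₂.mult * logEntry (s : G K) v₂ (1 - σ v₂) = 0 := by
  have hδ := h.det_ne_zero
  obtain ⟨u, hu⟩ := Units.dirichletUnitTheorem.exists_unit K v₁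
  obtain ⟨n, hn, hdvd⟩ := exists_pow_congr_one hδ u
  have hdvd2 : a 0 * b 1 - a 1 * b 0 ∣ (((u ^ n) ^ 2 : (𝓞 K)ˣ) : 𝓞 K) - 1 := by
    refine hdvd.trans ⟨((u ^ n : (𝓞 K)ˣ) : 𝓞 K) + 1, ?_⟩
    push_cast
    ring
  obtain ⟨γ, hγa, hγb⟩ := exists_SL_eigen hdvd2
  let U : (v : InfinitePlace K) → v.Completionˣ := fun v =>
    Units.map (emb v).toMonoidHom (u ^ n)
  have hU : ∀ v, ((U v ^ 2 : v.Completionˣ) : v.Completion) =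
      emb v (((u ^ n) ^ 2 : (𝓞 K)ˣ) : 𝓞 K) := by
    intro v
    simp [U]
  have hUi : ∀ v, (((U v ^ 2)⁻¹ : v.Completionˣ) : v.Completion) =
      emb v ((((u ^ n) ^ 2)⁻¹ : (𝓞 K)ˣ) : 𝓞 K) := by
    intro v
    simp only [U]
    rw [← map_pow, ← map_inv]
    rfl
  let s : G K := fun v => diagSL (1 - σ v) (U v ^ 2)
  have hs : s ∈ D K := mem_D_iff.2 fun v => diagSL_sq_mem_torusAt v _ _
  have hlog : ∀ v, logEntry s v (1 - σ v) = 2 * n * Real.log (v (u : K)) := by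
    intro v
    unfold logEntry
    simp only [s, diagSL_self]
    rw [hU, norm_emb]
    push_cast
    rw [map_pow, map_pow, Real.log_pow, Real.log_pow]
    push_cast
    ring
  have hsg : s * g = g * diagonalEmbedding K γ := by
    refine ext_of_act hδ (fun v j => ?_) (fun v j => ?_)
    · rw [act_diag_mul hs, act_mul_diagonalEmbedding, hγa, act_smul]
      by_cases hj : j = σ v
      · rw [hj, (h.2.2 v).1]; simp
      · obtain rfl := eq_other hj
        simp only [s, diagSL_self]
        rw [hU]
    · rw [act_diag_mul hs, act_mul_diagonalEmbedding, hγb, act_smul]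
      by_cases hj : j = σ v
      · subst hj
        have := diagSL_other (1 - σ v) (U v ^ 2)
        rw [sub_sub_cancel] at this
        simp only [s, this]
        rw [← Units.val_inv_eq_inv_val, hUi]
      · obtain rfl := eq_other hj
        rw [(h.2.2 v).2]; simp
  have hsum := Units.sum_mult_mul_log u
  rw [sum_places hne hall] at hsum
  have hneg := hu v₂ hne.symm
  have hn' : (0 : ℝ) < n := by exact_mod_cast hn
  refine ⟨⟨s, hs⟩, ?_, ?_, ?_⟩
  · rw [D_smul_proj]
    exact (proj_eq_iff.2 ⟨γ, by rw [hsg]; group⟩).symm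
  · simp only [hlog]
    have : 0 < Real.log (v₁ (u : K)) := by
      have h1 := mult_cast_pos v₁
      have h2 := mul_pos_of_neg_of_neg (neg_neg_of_pos (mult_cast_pos v₂)) hneg
      by_contra! hle
      have h3 := mul_nonpos_of_nonneg_of_nonpos h1.le hle
      linarith
    positivity
  · simp only [hlog]
    linear_combination (2 * n : ℝ) * hsum

/-- Orbits of matched points are closed: the heights of `a` and `b` bound the product of the
entries of `d`, and the units absorb the remaining direction. -/
lemma Matched.isClosed_orbit {g : G K} {a b : Fin 2 → 𝓞 K} {σ : InfinitePlace K → Fin 2}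
    (h : Matched g a b σ) (hr : Fintype.card (InfinitePlace K) = 2) :
    IsClosed (orbitD (proj K g)) := by
  obtain ⟨v₁, v₂, hne, hall⟩ := exists_places hr
  refine isClosed_of_closure_subset fun x hx => ?_
  obtain ⟨l, hl⟩ := exists_ultrafilter_of_mem_closure hx
  obtain ⟨s, hs, hs1, hs2⟩ := h.exists_stabilizer hne hall
  obtain ⟨C, hC⟩ := exists_height_bound hl h.1
  obtain ⟨C', hC'⟩ := exists_height_bound hl h.2.1
  set lam := v₁.mult * logEntry (s : G K) v₁ (1 - σ v₁) with hlam
  have hlam0 : 0 < lam := mul_pos (mult_cast_pos v₁) hs1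
  let y : D K → InfinitePlace K → ℝ := fun d v => v.mult * logEntry (d : G K) v (1 - σ v)
  let w : D K → D K := fun d => d * s ^ (-⌊y d v₁ / lam⌋)
  have hw : Tendsto (fun d => w d • proj K g) l (𝓝 x) := by
    refine hl.congr fun d => ?_
    have : s ^ (-⌊y d v₁ / lam⌋) • proj K g = proj K g :=
      (zpow_mem (MulAction.mem_stabilizer_iff.2 hs : s ∈ MulAction.stabilizer (D K) (proj K g))
        (-⌊y d v₁ / lam⌋))
    simp only [w, mul_smul, this]
  have hyw : ∀ d v, y (w d) v =
      y d v - ⌊y d v₁ / lam⌋ * (v.mult * logEntry (s : G K) v (1 - σ v)) := by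
    intro d v
    simp only [y, w, Subgroup.coe_mul, Subgroup.coe_zpow]
    rw [logEntry_mul d.2 (zpow_mem s.2 _), logEntry_zpow s.2]
    push_cast
    ring
  refine mem_orbit_of_bounded hw (B := lam + |C| + |C'|) (j := fun v => 1 - σ v) ?_
  filter_upwards [hC, hC'] with d hd hd' v
  have e1 : -C ≤ y d v₁ + y d v₂ := by
    have := hd (fun v => logEntry (d : G K) v (1 - σ v)) (fun v j hj => by
      obtain rfl := eq_other fun e : j = σ v => hj (e ▸ (h.2.2 v).1)
      exact le_rfl)
    rwa [sum_places hne hall] at this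
  have e2 : y d v₁ + y d v₂ ≤ C' := by
    have := hd' (fun v => -logEntry (d : G K) v (1 - σ v)) (fun v j hj => by
      obtain rfl : j = σ v := by
        rw [eq_other fun e : j = 1 - σ v => hj (e ▸ (h.2.2 v).2), sub_sub_cancel]
      rw [logEntry_other d.2, neg_neg])
    rw [sum_places hne hall] at this
    simp only [y]
    linarith
  have f1 : 0 ≤ y (w d) v₁ := by
    rw [hyw, ← hlam]
    have := (le_div_iff₀ hlam0).1 (Int.floor_le (y d v₁ / lam))
    linarith
  have f2 : y (w d) v₁ ≤ lam := by
    rw [hyw, ← hlam]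
    have := (div_lt_iff₀ hlam0).1 (Int.lt_floor_add_one (y d v₁ / lam))
    linarith
  have f3 : y (w d) v₁ + y (w d) v₂ = y d v₁ + y d v₂ := by
    rw [hyw, hyw]
    linear_combination -(⌊y d v₁ / lam⌋ : ℝ) * hs2
  have f4 : |y (w d) v| ≤ lam + |C| + |C'| := by
    have := le_abs_self C
    have := neg_abs_le C
    have := le_abs_self C'
    have := neg_abs_le C'
    have := abs_nonneg C
    have := abs_nonneg C'
    rcases hall v with rfl | rfl <;> exact abs_le.2 ⟨by linarith, by linarith⟩
  refine le_trans ?_ f4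
  have hm : (1 : ℝ) ≤ v.mult := by exact_mod_cast v.mult_pos
  simp only [y, abs_mul, Nat.abs_cast]
  exact le_mul_of_one_le_left (abs_nonneg _) hm

/-- Orbits of matched points are not compact: along them the vector `a` can be shrunk. -/
lemma Matched.not_isCompact_orbit {g : G K} {a b : Fin 2 → 𝓞 K} {σ : InfinitePlace K → Fin 2}
    (h : Matched g a b σ) : ¬ IsCompact (orbitD (proj K g)) := by
  intro hc
  let u : ℕ → D K := fun n => ⟨fun v => diagSL (1 - σ v) (expAt v (-(n : ℝ))),
    mem_D_iff.2 fun v => diagSL_expAt_mem_torusAt v _ _⟩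
  obtain ⟨x, -, hx⟩ := hc.ultrafilter_le_nhds
    ((hyperfilter ℕ).map fun n : ℕ => u n • proj K g)
    (le_principal_iff.2 (Ultrafilter.mem_map.2 (Filter.univ_mem' fun n => ⟨u n, rfl⟩)))
  obtain ⟨C, hC⟩ := exists_height_bound (u := u) (l := (hyperfilter ℕ : Filter ℕ)) hx h.1
  have hlarge : ∀ᶠ n : ℕ in (hyperfilter ℕ : Filter ℕ), C < n :=
    Nat.hyperfilter_le_atTop (tendsto_natCast_atTop_atTop.eventually_gt_atTop C)
  obtain ⟨n, hn, hn'⟩ := (hC.and hlarge).exists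
  have hlog : ∀ v, logEntry (u n : G K) v (1 - σ v) = -n := by
    intro v
    simp [logEntry, u, norm_expAt]
  have := hn (fun _ => -(n : ℝ)) (fun v j hj => by
    obtain rfl := eq_other fun e : j = σ v => hj (e ▸ (h.2.2 v).1)
    exact (hlog v).le)
  obtain ⟨v⟩ : Nonempty (InfinitePlace K) := inferInstance
  have h2 : (v.mult : ℝ) * n ≤ ∑ v : InfinitePlace K, (v.mult : ℝ) * n :=
    Finset.single_le_sum (f := fun v : InfinitePlace K => (v.mult : ℝ) * n)
      (fun w _ => by positivity) (Finset.mem_univ v)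
  simp only [mul_neg, Finset.sum_neg_distrib] at this
  have hm : (1 : ℝ) ≤ v.mult := by exact_mod_cast v.mult_pos
  have : (0 : ℝ) ≤ n := Nat.cast_nonneg n
  nlinarith

/-! ### The boundary of an orbit of a rational point -/

/-- Every row of every `g_v` kills a nonzero vector of `𝓞²`. -/
def Rational (g : G K) : Prop :=
  ∀ v j, ∃ k : Fin 2 → 𝓞 K, k ≠ 0 ∧ act g k v j = 0

/-- The rows `j v` of the matrices `g_v` all kill one line of `K²`. -/
def CommonKill (g : G K) (j : InfinitePlace K → Fin 2) : Prop :=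
  ∃ k : Fin 2 → 𝓞 K, k ≠ 0 ∧ ∀ v, act g k v (j v) = 0

lemma exists_matched_iff {g : G K} {σ : InfinitePlace K → Fin 2} :
    (∃ a b, Matched g a b σ) ↔ CommonKill g σ ∧ CommonKill g (1 - σ) := by
  constructor
  · rintro ⟨a, b, ha, hb, h⟩
    exact ⟨⟨a, ha, fun v => (h v).1⟩, ⟨b, hb, fun v => (h v).2⟩⟩
  · rintro ⟨⟨a, ha, h⟩, ⟨b, hb, h'⟩⟩
    exact ⟨a, b, ha, hb, fun v => ⟨h v, h' v⟩⟩

lemma CommonKill.of_mem_orbit {g h : G K} (hgh : proj K h ∈ orbitD (proj K g))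
    {j : InfinitePlace K → Fin 2} (hj : CommonKill h j) : CommonKill g j := by
  obtain ⟨d, hd⟩ := hgh
  obtain ⟨γ, hγ⟩ := exists_eq_mul_of_proj_eq (a := (d : G K) * g) (b := h) hd
  obtain ⟨k, hk, hkj⟩ := hj
  refine ⟨γ.1.mulVec k, mulVec_ne_zero γ hk, fun v => ?_⟩
  have := hkj v
  rw [hγ, act_mul_diagonalEmbedding, act_diag_mul d.2] at this
  exact (mul_eq_zero.1 this).resolve_left (D_ne_zero d.2 v _)

lemma orbitD_eq_of_mem {x y : Space K} (h : x ∈ orbitD y) : orbitD x = orbitD y :=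
  MulAction.orbit_eq_iff.2 h

/-- The unipotent matrix adding `c` times row `j` to the other row. -/
def shear {L : Type*} [Field L] (j : Fin 2) (c : L) : SL(2, L) :=
  ⟨Matrix.of fun a b => if a = b then 1 else if b = j then c else 0, by
    rw [Matrix.det_fin_two]
    fin_cases j <;> simp⟩

lemma shear_apply {L : Type*} [Field L] (j : Fin 2) (c : L) (a b : Fin 2) :
    shear j c a b = if a = b then 1 else if b = j then c else 0 := rfl

/-- The element of `G` with components `shear (j v) (c v)`. -/
noncomputable def shears (j : InfinitePlace K → Fin 2)
    (c : (v : InfinitePlace K) → v.Completion) : G K :=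
  fun v => shear (j v) (c v)

lemma act_shears_self (j : InfinitePlace K → Fin 2) (c : (v : InfinitePlace K) → v.Completion)
    (g : G K) (k : Fin 2 → 𝓞 K) (v : InfinitePlace K) :
    act (shears j c * g) k v (j v) = act g k v (j v) := by
  rw [act_mul]
  simp only [shears, shear_apply]
  generalize j v = i
  fin_cases i <;> simp

lemma act_shears_other (j : InfinitePlace K → Fin 2) (c : (v : InfinitePlace K) → v.Completion)
    (g : G K) (k : Fin 2 → 𝓞 K) (v : InfinitePlace K) :
    act (shears j c * g) k v (1 - j v) = act g k v (1 - j v) + c v * act g k v (j v) := by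
  rw [act_mul]
  simp only [shears, shear_apply]
  generalize j v = i
  fin_cases i <;> simp [add_comm]

lemma shears_neg_mul (j : InfinitePlace K → Fin 2) (c : (v : InfinitePlace K) → v.Completion) :
    shears j (-c) * shears j c = 1 := by
  funext v
  refine Matrix.SpecialLinearGroup.ext _ _ fun a b => ?_
  simp only [Pi.mul_apply, Matrix.SpecialLinearGroup.coe_mul, Matrix.mul_apply, Fin.sum_univ_two,
    shears, shear_apply, Pi.one_apply, Matrix.SpecialLinearGroup.coe_one, Matrix.one_apply,
    Pi.neg_apply]
  generalize j v = i
  fin_cases i <;> fin_cases a <;> fin_cases b <;> simp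

lemma D_mul_shears {d : G K} (hd : d ∈ D K) (j : InfinitePlace K → Fin 2)
    (c : (v : InfinitePlace K) → v.Completion) :
    d * shears j c = shears j (fun v => c v * d v (1 - j v) (1 - j v) ^ 2) * d := by
  funext v
  refine Matrix.SpecialLinearGroup.ext _ _ fun a b => ?_
  have h01 := D_offdiag hd v (show (0 : Fin 2) ≠ 1 by decide)
  have h10 := D_offdiag hd v (show (1 : Fin 2) ≠ 0 by decide)
  have h0 := D_mul_other hd v 0
  simp only [sub_zero] at h0
  simp only [Pi.mul_apply, Matrix.SpecialLinearGroup.coe_mul, Matrix.mul_apply, Fin.sum_univ_two,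
    shears, shear_apply]
  generalize j v = i
  fin_cases i <;> fin_cases a <;> fin_cases b <;> simp [h01, h10]
  · linear_combination -(d v 1 1 * c v) * h0
  · linear_combination -(d v 0 0 * c v) * h0

/-- If the rows `j v` are expanded by `u_i`, then shears along these rows do not affect the limit
of `u_i π(g)`. -/
lemma tendsto_shears_mul {ι : Type*} {l : Filter ι} {u : ι → D K} {g : G K} {x : Space K}
    {j : InfinitePlace K → Fin 2} (c : (v : InfinitePlace K) → v.Completion)
    (hu : ∀ v, Tendsto (fun i => logEntry (u i : G K) v (j v)) l atTop)
    (hx : Tendsto (fun i => u i • proj K g) l (𝓝 x)) :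
    Tendsto (fun i => u i • proj K (shears j c * g)) l (𝓝 x) := by
  have h1 : Tendsto (fun i => shears j
      (fun v => c v * (u i : G K) v (1 - j v) (1 - j v) ^ 2)) l (𝓝 1) := by
    refine tendsto_of_entries fun v a b => ?_
    simp only [shears, shear_apply, Pi.one_apply, Matrix.SpecialLinearGroup.coe_one,
      Matrix.one_apply]
    split_ifs
    · exact tendsto_const_nhds
    · have h2 : Tendsto (fun i => (u i : G K) v (1 - j v) (1 - j v)) l (𝓝 0) := by
        rw [tendsto_zero_iff_norm_tendsto_zero]
        have h3 : (fun i => ‖(u i : G K) v (1 - j v) (1 - j v)‖) =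
            fun i => Real.exp (-logEntry (u i : G K) v (j v)) := by
          funext i
          rw [norm_entry_eq_exp (u i).2, logEntry_other (u i).2]
        rw [h3]
        exact Real.tendsto_exp_neg_atTop_nhds_zero.comp (hu v)
      have h4 := (h2.pow 2).const_mul (c v)
      simpa using h4
    · exact tendsto_const_nhds
  have h2 := h1.smul hx
  rw [one_smul] at h2
  refine h2.congr fun i => ?_
  rw [D_smul_proj, smul_proj, D_smul_proj, ← mul_assoc, ← D_mul_shears (u i).2, mul_assoc]

/-- The limit point of `D π(g)` in the direction expanding the rows `j v`: the other row at
each place is replaced by a form killing the kernel of row `j` at the other place. -/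
lemma exists_companion {g : G K} (hg : Rational g) {v₁ v₂ : InfinitePlace K} (hne : v₁ ≠ v₂)
    (hall : ∀ v, v = v₁ ∨ v = v₂) {j : InfinitePlace K → Fin 2} (hj : ¬ CommonKill g j) :
    ∃ c : (v : InfinitePlace K) → v.Completion, ∃ a b : Fin 2 → 𝓞 K, ∃ σ,
      σ v₁ = j v₁ ∧ σ v₂ = 1 - j v₂ ∧ Matched (shears j c * g) a b σ := by
  classical
  obtain ⟨a, ha, hka⟩ := hg v₁ (j v₁)
  obtain ⟨b, hb, hkb⟩ := hg v₂ (j v₂)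
  have ha2 : act g a v₂ (j v₂) ≠ 0 := fun h => hj ⟨a, ha, fun v => by
    rcases hall v with rfl | rfl <;> assumption⟩
  have hb1 : act g b v₁ (j v₁) ≠ 0 := fun h => hj ⟨b, hb, fun v => by
    rcases hall v with rfl | rfl <;> assumption⟩
  let o : InfinitePlace K → Fin 2 → 𝓞 K := fun v => if v = v₁ then b else a
  have ho1 : o v₁ = b := if_pos rfl
  have ho2 : o v₂ = a := if_neg hne.symm
  let c : (v : InfinitePlace K) → v.Completion := fun v =>
    -act g (o v) v (1 - j v) / act g (o v) v (j v)
  refine ⟨c, a, b, fun v => if v = v₁ then j v else 1 - j v, if_pos rfl, if_neg hne.symm,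
    ha, hb, fun v => ?_⟩
  rcases hall v with rfl | rfl
  · simp only [if_true]
    refine ⟨by rw [act_shears_self, hka], ?_⟩
    rw [act_shears_other]
    simp only [c, ho1]
    field_simp
    ring
  · simp only [if_neg hne.symm, sub_sub_cancel]
    refine ⟨?_, by rw [act_shears_self, hkb]⟩
    rw [act_shears_other]
    simp only [c, ho2]
    field_simp
    ring

/-- A limit point of `D π(g)` outside the orbit is reached in a direction expanding rows `j v`
without common kernel. -/
lemma exists_direction {g : G K} (hg : Rational g) (hr : Fintype.card (InfinitePlace K) = 2)
    {x : Space K} (hx : x ∈ closure (orbitD (proj K g))) (hx' : x ∉ orbitD (proj K g)) :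
    ∃ j, ¬ CommonKill g j ∧ ∃ l : Ultrafilter (D K),
      Tendsto (fun d : D K => d • proj K g) l (𝓝 x) ∧
      ∀ v, Tendsto (fun d : D K => logEntry (d : G K) v (j v)) l atTop := by
  obtain ⟨v₁, v₂, hne, hall⟩ := exists_places hr
  obtain ⟨l, hl⟩ := exists_ultrafilter_of_mem_closure hx
  have hj : ∀ v, ∃ i, ∀ᶠ d : D K in l, 0 ≤ logEntry (d : G K) v i := by
    intro v
    by_cases h0 : ∀ᶠ d : D K in l, 0 ≤ logEntry (d : G K) v 0
    · exact ⟨0, h0⟩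
    · rw [← Ultrafilter.eventually_not] at h0
      refine ⟨1 - 0, h0.mono fun d hd => ?_⟩
      rw [logEntry_other d.2]
      linarith
  choose j hj using hj
  have hpos : ∀ᶠ d : D K in l, ∀ v, 0 ≤ logEntry (d : G K) v (j v) := eventually_all.2 hj
  -- the kernel of row `j` at `v` bounds the expansion at `v` by the expansion at `w`
  have hcomp : ∀ v w, v ≠ w → (∀ z, z = v ∨ z = w) → ∃ C : ℝ, ∀ᶠ d : D K in l,
      v.mult * logEntry (d : G K) v (j v) ≤ w.mult * logEntry (d : G K) w (j w) + C := by
    classical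
    intro v w hvw hz
    obtain ⟨k, hk, hkv⟩ := hg v (j v)
    obtain ⟨C, hC⟩ := exists_height_bound hl hk
    refine ⟨C, ?_⟩
    filter_upwards [hC, hpos] with d hd hp
    have := hd (fun z => if z = v then -logEntry (d : G K) z (j z)
      else logEntry (d : G K) z (j z)) (fun z i hi => by
        rcases hz z with rfl | rfl
        · obtain rfl := eq_other fun e : i = j z => hi (e ▸ hkv)
          rw [if_pos rfl, logEntry_other d.2]
        · rw [if_neg hvw.symm, ← abs_of_nonneg (hp z), ← abs_logEntry d.2 z i]
          exact le_abs_self _)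
    rw [sum_places hvw hz] at this
    simp only [if_true, if_neg hvw.symm] at this
    linarith
  obtain ⟨C, hC⟩ := hcomp v₁ v₂ hne hall
  obtain ⟨C', hC'⟩ := hcomp v₂ v₁ hne.symm fun z => (hall z).symm
  have hm : ∀ v : InfinitePlace K, (1 : ℝ) ≤ v.mult := fun v => by exact_mod_cast v.mult_pos
  -- the direction is unbounded, since otherwise the limit lies on the orbit
  have hunb : ∀ B : ℝ, ∀ᶠ d : D K in l, B < v₁.mult * logEntry (d : G K) v₁ (j v₁) := by
    intro B
    by_contra h
    rw [← Ultrafilter.eventually_not] at h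
    refine hx' (mem_orbit_of_bounded hl (B := |B| + |C'|) (j := j) ?_)
    filter_upwards [h, hC', hpos] with d h1 h2 h3 v
    rw [abs_of_nonneg (h3 v)]
    have := le_mul_of_one_le_left (h3 v) (hm v)
    have := le_abs_self B
    have := le_abs_self C'
    have := abs_nonneg C'
    rcases hall v with rfl | rfl <;> linarith
  refine ⟨j, ?_, l, hl, ?_⟩
  · rintro ⟨k, hk, hkj⟩
    obtain ⟨C₀, hC₀⟩ := exists_height_bound hl hk
    obtain ⟨d, h1, h2, h3⟩ := (hC₀.and ((hunb C₀).and hpos)).exists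
    have := h1 (fun v => -logEntry (d : G K) v (j v)) (fun v i hi => by
      obtain rfl := eq_other fun e : i = j v => hi (e ▸ hkj v)
      rw [logEntry_other d.2])
    rw [sum_places hne hall] at this
    have := mul_nonneg (mult_cast_pos v₂).le (h3 v₂)
    linarith
  · intro v
    refine tendsto_atTop.2 fun B => ?_
    filter_upwards [hunb (v.mult * B), hunb (v.mult * B + C), hC] with d h1 h2 h3
    refine le_of_mul_le_mul_left ?_ (mult_cast_pos v)
    rcases hall v with rfl | rfl <;> linarith

/-- The orbit of a companion point lies in the closure. -/
lemma orbit_companion_subset {g : G K} {v₁ v₂ : InfinitePlace K} (hne : v₁ ≠ v₂)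
    (hall : ∀ v, v = v₁ ∨ v = v₂) {j : InfinitePlace K → Fin 2}
    {c : (v : InfinitePlace K) → v.Completion} {a b : Fin 2 → 𝓞 K}
    {σ : InfinitePlace K → Fin 2} (h1 : σ v₁ = j v₁) (h2 : σ v₂ = 1 - j v₂)
    (hm : Matched (shears j c * g) a b σ) :
    orbitD (proj K (shears j c * g)) ⊆ closure (orbitD (proj K g)) := by
  rintro _ ⟨d, rfl⟩
  obtain ⟨s, hs, hs2, hsum⟩ := hm.exists_stabilizer hne.symm fun v => (hall v).symm
  rw [h2, sub_sub_cancel] at hs2 hsum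
  rw [h1, logEntry_other s.2] at hsum
  have hs1 : 0 < logEntry (s : G K) v₁ (j v₁) := by
    have h3 := mul_pos (mult_cast_pos v₂) hs2
    refine pos_of_mul_pos_right (a := (v₁.mult : ℝ)) ?_ (mult_cast_pos v₁).le
    linarith
  have hpow : ∀ n : ℕ, s ^ n • proj K (shears j c * g) = proj K (shears j c * g) := fun n =>
    pow_mem (MulAction.mem_stabilizer_iff.2 hs :
      s ∈ MulAction.stabilizer (D K) (proj K (shears j c * g))) n
  have ht : Tendsto (fun n : ℕ => (d * s ^ n) • proj K (shears j c * g)) atTop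
      (𝓝 (d • proj K (shears j c * g))) := by
    simp only [mul_smul, hpow]
    exact tendsto_const_nhds
  have hinf : ∀ v, Tendsto (fun n : ℕ => logEntry ((d * s ^ n : D K) : G K) v (j v))
      atTop atTop := by
    intro v
    have hpos : 0 < logEntry (s : G K) v (j v) := by
      rcases hall v with rfl | rfl <;> assumption
    have h4 : (fun n : ℕ => logEntry ((d * s ^ n : D K) : G K) v (j v)) =
        fun n : ℕ => logEntry (d : G K) v (j v) + n * logEntry (s : G K) v (j v) := by
      funext n
      rw [Subgroup.coe_mul, Subgroup.coe_pow, logEntry_mul d.2 (pow_mem s.2 n), logEntry_pow s.2]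
    rw [h4]
    exact tendsto_atTop_add_const_left _ _
      (tendsto_natCast_atTop_atTop.atTop_mul_const hpos)
  have h5 := tendsto_shears_mul (-c) hinf ht
  rw [← mul_assoc, shears_neg_mul, one_mul] at h5
  exact mem_closure_of_tendsto h5 (Filter.Eventually.of_forall fun n => ⟨_, rfl⟩)

/-- The boundary of the orbit of a rational point that is not matched. -/
theorem boundary_of_not_matched {g : G K} (hg : Rational g)
    (hr : Fintype.card (InfinitePlace K) = 2)
    (hnm : ∀ σ, ¬ (CommonKill g σ ∧ CommonKill g (1 - σ))) :
    ∃ s : ℕ, 2 ≤ s ∧ s ≤ 4 ∧ ∃ h : Fin s → G K,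
      closure (orbitD (proj K g)) \ orbitD (proj K g) = ⋃ i, orbitD (proj K (h i)) ∧
      (Pairwise fun i j => orbitD (proj K (h i)) ≠ orbitD (proj K (h j))) ∧
      ∀ i, IsClosed (orbitD (proj K (h i))) ∧ ¬ IsCompact (orbitD (proj K (h i))) := by
  classical
  obtain ⟨v₁, v₂, hne, hall⟩ := exists_places hr
  let I := {j : InfinitePlace K → Fin 2 // ¬ CommonKill g j}
  choose c a b σ hσ1 hσ2 hm using fun i : I => exists_companion hg hne hall i.2
  let H : I → G K := fun i => shears i.1 (c i) * g
  have hHck : ∀ i : I, ¬ CommonKill (H i) i.1 := by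
    rintro i ⟨k, hk, hki⟩
    exact i.2 ⟨k, hk, fun v => by rw [← act_shears_self i.1 (c i)]; exact hki v⟩
  have hHm : ∀ i : I, CommonKill (H i) (σ i) ∧ CommonKill (H i) (1 - σ i) := fun i =>
    exists_matched_iff.1 ⟨_, _, hm i⟩
  let T : Finset (Set (Space K)) := Finset.univ.image fun i : I => orbitD (proj K (H i))
  have hT : ∀ t : T, ∃ i : I, orbitD (proj K (H i)) = t := by
    rintro ⟨t, ht⟩
    obtain ⟨i, -, hi⟩ := Finset.mem_image.1 ht
    exact ⟨i, hi⟩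
  choose r hr' using hT
  let e := T.equivFin.symm
  refine ⟨T.card, ?_, ?_, fun n => H (r (e n)), ?_, ?_, ?_⟩
  · -- one expanding direction of each of the two types `{(0,0), (1,1)}` and `{(0,1), (1,0)}`
    have hpick : ∀ j : InfinitePlace K → Fin 2, ∃ i : I, i.1 = j ∨ i.1 = 1 - j := by
      intro j
      by_cases h : CommonKill g j
      · exact ⟨⟨1 - j, fun h' => hnm j ⟨h, h'⟩⟩, Or.inr rfl⟩
      · exact ⟨⟨j, h⟩, Or.inl rfl⟩
    obtain ⟨i₀, hi₀⟩ := hpick fun _ => 0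
    obtain ⟨i₁, hi₁⟩ := hpick fun v => if v = v₁ then 0 else 1
    refine Finset.one_lt_card.2 ⟨_, Finset.mem_image_of_mem _ (Finset.mem_univ i₀), _,
      Finset.mem_image_of_mem _ (Finset.mem_univ i₁), fun heq => hHck i₀ ?_⟩
    have hmem : proj K (H i₁) ∈ orbitD (proj K (H i₀)) :=
      heq ▸ MulAction.mem_orbit_self _
    refine CommonKill.of_mem_orbit hmem ?_
    have hfun : ∀ f f' : InfinitePlace K → Fin 2, f v₁ = f' v₁ → f v₂ = f' v₂ → f = f' := by
      intro f f' h1 h2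
      funext v
      rcases hall v with rfl | rfl <;> assumption
    have h0 : i₀.1 v₁ = i₀.1 v₂ := by rcases hi₀ with h | h <;> simp [h]
    have h1 : i₁.1 v₂ = 1 - i₁.1 v₁ := by
      rcases hi₁ with h | h <;> (rw [h]; simp [hne.symm])
    have hσ : i₀.1 = σ i₁ ∨ i₀.1 = 1 - σ i₁ := by
      by_cases hq : i₀.1 v₁ = i₁.1 v₁
      · refine Or.inl (hfun _ _ (by rw [hσ1, hq]) ?_)
        rw [hσ2, h1, sub_sub_cancel, ← h0, hq]
      · have hq' := eq_other hq
        refine Or.inr (hfun _ _ ?_ ?_)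
        · rw [Pi.sub_apply, hσ1, hq']; rfl
        · rw [Pi.sub_apply, hσ2, h1, sub_sub_cancel, ← h0, hq']; rfl
    rcases hσ with h | h <;> rw [h]
    exacts [(hHm i₁).1, (hHm i₁).2]
  · calc T.card ≤ Fintype.card I := Finset.card_image_le
      _ ≤ Fintype.card (InfinitePlace K → Fin 2) := Fintype.card_subtype_le _
      _ = 4 := by rw [Fintype.card_fun, hr, Fintype.card_fin]; norm_num
  · ext x
    constructor
    · rintro ⟨hx, hx'⟩
      obtain ⟨j, hj, l, hl, hinf⟩ := exists_direction hg hr hx hx'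
      have h1 := tendsto_shears_mul (c ⟨j, hj⟩) hinf hl
      have h2 : x ∈ orbitD (proj K (H ⟨j, hj⟩)) :=
        ((hm ⟨j, hj⟩).isClosed_orbit hr).mem_of_tendsto h1
          (Filter.Eventually.of_forall fun d => ⟨d, rfl⟩)
      let t : T := ⟨_, Finset.mem_image_of_mem _ (Finset.mem_univ ⟨j, hj⟩)⟩
      refine Set.mem_iUnion.2 ⟨e.symm t, ?_⟩
      simp only [Equiv.apply_symm_apply, hr' t]
      exact h2
    · intro hx
      obtain ⟨n, hn⟩ := Set.mem_iUnion.1 hx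
      set i := r (e n)
      refine ⟨orbit_companion_subset hne hall (hσ1 i) (hσ2 i) (hm i) hn, fun hx' => ?_⟩
      have hmem : proj K (H i) ∈ orbitD (proj K g) := by
        rw [← orbitD_eq_of_mem hx', orbitD_eq_of_mem hn]
        exact MulAction.mem_orbit_self _
      exact hnm (σ i) ⟨(hHm i).1.of_mem_orbit hmem, (hHm i).2.of_mem_orbit hmem⟩
  · intro m n hmn heq
    simp only [hr'] at heq
    exact hmn (e.injective (Subtype.ext heq))
  · intro n
    exact ⟨(hm _).isClosed_orbit hr, (hm _).not_isCompact_orbit⟩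

/-! ### Short vectors -/

variable (K) in
/-- The space `∏ K_v²` in which the lattices `g 𝓞²` live. -/
abbrev VecSpace : Type _ := (v : InfinitePlace K) → Fin 2 → v.Completion

/-- Coordinatewise multiplication by units, as an automorphism of `∏ K_v²`. -/
noncomputable def scaleEquiv (x : (v : InfinitePlace K) → Fin 2 → v.Completionˣ) :
    VecSpace K ≃ₜ+ VecSpace K where
  toFun y v j := x v j * y v j
  invFun y v j := ((x v j)⁻¹ : v.Completionˣ) * y v j
  left_inv y := by funext v j; simp
  right_inv y := by funext v j; simp
  map_add' y z := by funext v j; simp [mul_add]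
  continuous_toFun := by
    refine continuous_pi fun v => continuous_pi fun j => continuous_const.mul ?_
    exact (continuous_apply j).comp (continuous_apply v)
  continuous_invFun := by
    refine continuous_pi fun v => continuous_pi fun j => continuous_const.mul ?_
    exact (continuous_apply j).comp (continuous_apply v)

variable (K) in
/-- The exchange of the two coordinates at every place. -/
noncomputable def swapEquiv : VecSpace K ≃ₜ+ VecSpace K where
  toFun y v j := y v (1 - j)
  invFun y v j := y v (1 - j)
  left_inv y := by funext v j; simp
  right_inv y := by funext v j; simp
  map_add' y z := rfl
  continuous_toFun := continuous_pi fun v => continuous_pi fun j =>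
    (continuous_apply (1 - j)).comp (continuous_apply v)
  continuous_invFun := continuous_pi fun v => continuous_pi fun j =>
    (continuous_apply (1 - j)).comp (continuous_apply v)

/-- Diagonal matrices of determinant one preserve Haar measure, since exchanging the coordinates
conjugates them to their inverses. -/
lemma addHaarChar_scaleEquiv [MeasurableSpace (VecSpace K)] [BorelSpace (VecSpace K)]
    {x : (v : InfinitePlace K) → Fin 2 → v.Completionˣ}
    (hx : ∀ v j, x v (1 - j) = (x v j)⁻¹) : addEquivAddHaarChar (scaleEquiv x) = 1 := by
  have h1 : (((swapEquiv K).trans (scaleEquiv x)).trans (swapEquiv K)).trans (scaleEquiv x) =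
      ContinuousAddEquiv.refl (VecSpace K) := by
    ext1 y
    funext v j
    change (x v j : v.Completion) * (x v (1 - j) * y v (1 - (1 - j))) = y v j
    rw [hx, sub_sub_cancel, Units.mul_inv_cancel_left]
  have h2 : (swapEquiv K).trans (swapEquiv K) = ContinuousAddEquiv.refl (VecSpace K) := by
    ext1 y
    funext v j
    change y v (1 - (1 - j)) = y v j
    rw [sub_sub_cancel]
  have e1 := congrArg addEquivAddHaarChar h1
  have e2 := congrArg addEquivAddHaarChar h2
  simp only [addEquivAddHaarChar_trans, addEquivAddHaarChar_refl] at e1 e2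
  have e3 : addEquivAddHaarChar (scaleEquiv x) ^ 2 = 1 := by
    calc addEquivAddHaarChar (scaleEquiv x) ^ 2
        = (addEquivAddHaarChar (swapEquiv K) * addEquivAddHaarChar (swapEquiv K)) *
          addEquivAddHaarChar (scaleEquiv x) ^ 2 := by rw [e2, one_mul]
      _ = 1 := by rw [← e1]; ring
  exact (pow_eq_one_iff_of_nonneg zero_le two_ne_zero).1 e3

variable (K) in
/-- The ring of integers is cocompact in `∏ K_v`. -/
lemma exists_integer_approx : ∃ B : ℝ, 0 < B ∧ ∀ x : (v : InfinitePlace K) → v.Completion,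
    ∃ o : 𝓞 K, ∀ v, ‖x v - emb v o‖ ≤ B := by
  classical
  let b := mixedEmbedding.latticeBasis K
  refine ⟨1 + ∑ i, ‖b i‖, by positivity, fun x => ?_⟩
  let m := InfiniteAdeleRing.ringEquiv_mixedSpace K x
  have hmem := (mixedEmbedding.mem_span_latticeBasis K).1 (ZSpan.floor b m).2
  obtain ⟨o, ho⟩ := hmem
  have hle := ZSpan.norm_fract_le b m
  rw [ZSpan.fract_apply] at hle
  let X : InfiniteAdeleRing K := x
  let Y : InfiniteAdeleRing K := fun v => emb v o
  have ho' : ((ZSpan.floor b m : mixedEmbedding.mixedSpace K)) =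
      InfiniteAdeleRing.ringEquiv_mixedSpace K Y := by
    rw [← ho]
    exact InfiniteAdeleRing.mixedEmbedding_eq_algebraMap_comp K
  have hm : m - InfiniteAdeleRing.ringEquiv_mixedSpace K Y =
      InfiniteAdeleRing.ringEquiv_mixedSpace K (X - Y) :=
    (map_sub (InfiniteAdeleRing.ringEquiv_mixedSpace K) X Y).symm
  rw [ho', hm] at hle
  refine ⟨o, fun v => ?_⟩
  set y : InfiniteAdeleRing K := X - Y
  have hy : x v - emb v o = y v := rfl
  rw [hy]
  refine le_trans ?_ (hle.trans (by linarith))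
  rw [InfiniteAdeleRing.ringEquiv_mixedSpace_apply]
  by_cases hv : v.IsReal
  · refine le_trans (le_of_eq ?_) ((norm_le_pi_norm _ (⟨v, hv⟩ : {w : InfinitePlace K //
      w.IsReal})).trans (norm_fst_le _))
    exact ((InfinitePlace.Completion.isometry_extensionEmbeddingOfIsReal
      hv).norm_map_of_map_zero (map_zero _) _).symm
  · have hv' := InfinitePlace.not_isReal_iff_isComplex.1 hv
    refine le_trans (le_of_eq ?_) ((norm_le_pi_norm _ (⟨v, hv'⟩ : {w : InfinitePlace K //
      w.IsComplex})).trans (norm_snd_le _))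
    exact ((InfinitePlace.Completion.isometry_extensionEmbedding
      v).norm_map_of_map_zero (map_zero _) _).symm

/-- The lattice `g 𝓞²` is cocompact in `∏ K_v²`. -/
lemma exists_lattice_approx (g : G K) : ∃ B : ℝ, 0 < B ∧ ∀ x : VecSpace K,
    ∃ k : Fin 2 → 𝓞 K, ‖x - act g k‖ ≤ B := by
  obtain ⟨B₀, hB₀, h⟩ := exists_integer_approx K
  obtain ⟨B₁, hB₁, hg⟩ := exists_entries_lt g
  refine ⟨2 * B₁ * B₀, by positivity, fun x => ?_⟩
  obtain ⟨o₀, h₀⟩ := h fun v => g v 1 1 * x v 0 - g v 0 1 * x v 1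
  obtain ⟨o₁, h₁⟩ := h fun v => g v 0 0 * x v 1 - g v 1 0 * x v 0
  refine ⟨![o₀, o₁], ?_⟩
  refine (pi_norm_le_iff_of_nonneg (by positivity)).2 fun v =>
    (pi_norm_le_iff_of_nonneg (by positivity)).2 fun j => ?_
  have hdet := det_entries g v
  have e : (x - act g ![o₀, o₁]) v j =
      g v j 0 * (g v 1 1 * x v 0 - g v 0 1 * x v 1 - emb v o₀) +
      g v j 1 * (g v 0 0 * x v 1 - g v 1 0 * x v 0 - emb v o₁) := by
    simp only [Pi.sub_apply, act, Matrix.cons_val_zero, Matrix.cons_val_one]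
    fin_cases j
    · simp only [Fin.zero_eta]
      linear_combination -(x v 0) * hdet
    · simp only [Fin.mk_one]
      linear_combination -(x v 1) * hdet
  rw [e]
  refine (norm_add_le _ _).trans ?_
  rw [norm_mul, norm_mul]
  have := mul_le_mul (hg v j 0).le (h₀ v) (norm_nonneg _) hB₁.le
  have := mul_le_mul (hg v j 1).le (h₁ v) (norm_nonneg _) hB₁.le
  linarith

/-- Minkowski's theorem for the lattices `d g 𝓞²`, uniformly in `d ∈ D`. -/
lemma exists_short_vector (g : G K) : ∃ R : ℝ, 0 < R ∧ ∀ d ∈ D K,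
    ∃ k : Fin 2 → 𝓞 K, k ≠ 0 ∧ ∀ v j, ‖act (d * g) k v j‖ ≤ R := by
  borelize (VecSpace K)
  obtain ⟨B, hB, hcover⟩ := exists_lattice_approx g
  let μ : Measure (VecSpace K) := Measure.addHaar
  set F := Metric.closedBall (0 : VecSpace K) B with hF
  have hFtop : μ F ≠ ⊤ := (isCompact_closedBall _ _).measure_ne_top
  have hF0 : μ F ≠ 0 :=
    (μ.measure_pos_of_mem_nhds (Metric.closedBall_mem_nhds (0 : VecSpace K) hB)).ne'
  -- a ball large enough to contain two disjoint translates of the fundamental set `F`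
  set R : ℝ := 3 * B + 1 with hR
  set t : VecSpace K := fun v _ => realLift v (2 * B + 1) with ht
  have htnorm : ‖t‖ ≤ 2 * B + 1 := by
    refine (pi_norm_le_iff_of_nonneg (by positivity)).2 fun v =>
      (pi_norm_le_iff_of_nonneg (by positivity)).2 fun j => ?_
    rw [ht, norm_realLift, abs_of_pos (by positivity)]
  have htnorm' : 2 * B < ‖t‖ := by
    obtain ⟨v⟩ : Nonempty (InfinitePlace K) := inferInstance
    have h1 := (norm_le_pi_norm (t v) 0).trans (norm_le_pi_norm t v)
    rw [ht, norm_realLift, abs_of_pos (by positivity)] at h1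
    linarith
  have hball : μ F < μ (Metric.closedBall (0 : VecSpace K) R) := by
    have hdisj : Disjoint F ((fun y => y - t) ⁻¹' F) := by
      rw [Set.disjoint_left]
      intro y hy hy'
      simp only [hF, Set.mem_preimage, mem_closedBall_zero_iff] at hy hy'
      have := norm_sub_le y (y - t)
      rw [sub_sub_cancel] at this
      linarith
    have hsub : F ∪ ((fun y => y - t) ⁻¹' F) ⊆ Metric.closedBall (0 : VecSpace K) R := by
      rintro y (hy | hy)
      · simp only [hF, mem_closedBall_zero_iff] at hy ⊢
        linarith
      · simp only [hF, Set.mem_preimage, mem_closedBall_zero_iff] at hy ⊢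
        have := norm_add_le (y - t) t
        rw [sub_add_cancel] at this
        linarith
    refine lt_of_lt_of_le ?_ (measure_mono hsub)
    have hpre : μ ((fun y => y - t) ⁻¹' F) = μ F := by
      simp only [sub_eq_add_neg]
      exact measure_preimage_add_right μ (-t) F
    rw [measure_union hdisj ((Metric.isClosed_closedBall.preimage (by fun_prop)).measurableSet),
      hpre]
    exact ENNReal.lt_add_right hFtop hF0
  refine ⟨2 * R, by positivity, fun d hd => ?_⟩
  by_contra! hno
  let x : (v : InfinitePlace K) → Fin 2 → v.Completionˣ := fun v j =>
    Units.mk0 (d v j j) (D_ne_zero hd v j)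
  have hx : ∀ v j, x v (1 - j) = (x v j)⁻¹ := by
    intro v j
    refine (inv_eq_of_mul_eq_one_right ?_).symm
    ext1
    exact D_mul_other hd v j
  set S := scaleEquiv x ⁻¹' Metric.closedBall (0 : VecSpace K) R with hS
  have hSμ : μ S = μ (Metric.closedBall (0 : VecSpace K) R) := by
    have := addEquivAddHaarChar_smul_preimage μ (X := Metric.closedBall (0 : VecSpace K) R)
      (scaleEquiv x)
    rwa [addHaarChar_scaleEquiv hx, one_smul] at this
  have hSclosed : IsClosed S :=
    Metric.isClosed_closedBall.preimage (scaleEquiv x).continuous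
  let A : (Fin 2 → 𝓞 K) → Set (VecSpace K) := fun k => F ∩ (fun y => y + act g k) ⁻¹' S
  have hAmeas : ∀ k, MeasurableSet (A k) := fun k =>
    (Metric.isClosed_closedBall.inter (hSclosed.preimage (by fun_prop))).measurableSet
  have hAdisj : Pairwise (Function.onFun Disjoint A) := by
    intro k k' hkk
    rw [Function.onFun, Set.disjoint_left]
    rintro y ⟨-, hy⟩ ⟨-, hy'⟩
    obtain ⟨v, j, hvj⟩ := hno (k - k') (sub_ne_zero.2 hkk)
    simp only [hS, Set.mem_preimage, mem_closedBall_zero_iff] at hy hy'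
    have h1 := (norm_le_pi_norm _ j).trans ((norm_le_pi_norm _ v).trans hy)
    have h2 := (norm_le_pi_norm _ j).trans ((norm_le_pi_norm _ v).trans hy')
    have h3 : act (d * g) (k - k') v j =
        scaleEquiv x (y + act g k) v j - scaleEquiv x (y + act g k') v j := by
      rw [act_diag_mul hd, act_sub]
      change _ = d v j j * (y v j + act g k v j) - d v j j * (y v j + act g k' v j)
      ring
    rw [h3] at hvj
    have := norm_sub_le (scaleEquiv x (y + act g k) v j) (scaleEquiv x (y + act g k') v j)
    linarith
  have hcov : S ⊆ ⋃ k, (fun y => y - act g k) ⁻¹' A k := by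
    intro y hy
    obtain ⟨k, hk⟩ := hcover y
    refine Set.mem_iUnion.2 ⟨k, ?_, ?_⟩
    · simpa [hF] using hk
    · simpa using hy
  have : μ S ≤ μ F := calc
    μ S ≤ ∑' k, μ ((fun y => y - act g k) ⁻¹' A k) :=
      (measure_mono hcov).trans (measure_iUnion_le _)
    _ = ∑' k, μ (A k) := by
      congr 1
      funext k
      simp only [sub_eq_add_neg]
      exact measure_preimage_add_right μ (-act g k) (A k)
    _ = μ (⋃ k, A k) := (measure_iUnion hAdisj hAmeas).symm
    _ ≤ μ F := measure_mono (Set.iUnion_subset fun k => Set.inter_subset_left)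
  exact absurd (hSμ ▸ this) (not_le.2 hball)

/-! ### Locally divergent points are rational -/

open scoped Classical in
/-- The element of the factor `D_v` with entry `e ^ t` in row `j`. -/
noncomputable def flow (v : InfinitePlace K) (j : Fin 2) (t : ℝ) : G K :=
  Pi.mulSingle v (diagSL j (expAt v t))

lemma flow_self (v : InfinitePlace K) (j : Fin 2) (t : ℝ) :
    flow v j t v = diagSL j (expAt v t) := by
  classical
  simp [flow]

lemma flow_of_ne {v w : InfinitePlace K} (h : w ≠ v) (j : Fin 2) (t : ℝ) :
    flow v j t w = 1 := by
  classical
  simp [flow, h]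

lemma flow_mem_factor (v : InfinitePlace K) (j : Fin 2) (t : ℝ) : flow v j t ∈ factor v :=
  ⟨by rw [flow_self]; exact diagSL_expAt_mem_torusAt v j t, fun _ hw => flow_of_ne hw j t⟩

lemma factor_le_D (v : InfinitePlace K) : factor v ≤ D K := by
  intro g hg
  refine mem_D_iff.2 fun w => ?_
  by_cases h : w = v
  · subst h; exact hg.1
  · rw [hg.2 w h]; exact one_mem _

lemma flow_mem_D (v : InfinitePlace K) (j : Fin 2) (t : ℝ) : flow v j t ∈ D K :=
  factor_le_D v (flow_mem_factor v j t)

lemma continuous_flow (v : InfinitePlace K) (j : Fin 2) : Continuous (flow v j) := by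
  classical
  exact (continuous_mulSingle v).comp (continuous_diagSL j (continuous_expAt v))

lemma norm_flow_self (v : InfinitePlace K) (j : Fin 2) (t : ℝ) :
    ‖flow v j t v j j‖ = Real.exp t := by
  rw [flow_self, diagSL_self, norm_expAt]

lemma norm_flow_of_ne {v w : InfinitePlace K} (h : w ≠ v) (j i : Fin 2) (t : ℝ) :
    ‖flow v j t w i i‖ = 1 := by
  rw [flow_of_ne h]; simp

lemma parallel_trans {k l m : Fin 2 → 𝓞 K} (hk : k ≠ 0) (h1 : k 0 * l 1 = k 1 * l 0)
    (h2 : k 0 * m 1 = k 1 * m 0) : l 0 * m 1 = l 1 * m 0 := by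
  obtain ⟨i, hi⟩ := ne_zero_iff_entry.1 hk
  refine mul_left_cancel₀ hi ?_
  fin_cases i
  · simp only [Fin.zero_eta]
    linear_combination l 0 * h2 - m 0 * h1
  · simp only [Fin.mk_one]
    linear_combination l 1 * h2 - m 1 * h1

/-- A line not killed by row `j` of `g_v` cannot contain short vectors of `flow v j t * g`
for all large `t`. -/
lemma not_forall_short_on_line {g : G K} {v : InfinitePlace K} {j : Fin 2} {k₀ : Fin 2 → 𝓞 K}
    (hk₀ : k₀ ≠ 0) (hv : act g k₀ v j ≠ 0) {C T : ℝ}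
    (h : ∀ t ≥ T, ∃ k : Fin 2 → 𝓞 K, k ≠ 0 ∧ k 0 * k₀ 1 = k 1 * k₀ 0 ∧
      ∀ w i, ‖act (flow v j t * g) k w i‖ < C) : False := by
  classical
  choose i₀ hi₀ using fun w => exists_act_ne_zero g hk₀ w
  let r : InfinitePlace K → Fin 2 := fun w => if w = v then j else i₀ w
  have hr : ∀ w, act g k₀ w (r w) ≠ 0 := by
    intro w
    by_cases hw : w = v
    · subst hw; simpa [r] using hv
    · simpa [r, hw] using hi₀ w
  obtain ⟨i, hi⟩ := ne_zero_iff_entry.1 hk₀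
  set Q := ∏ w : InfinitePlace K, ‖act g k₀ w (r w)‖ ^ w.mult with hQ
  have hQ0 : 0 < Q := Finset.prod_pos fun w _ => pow_pos (norm_pos_iff.2 (hr w)) _
  set E := ∏ w : InfinitePlace K, (‖emb w (k₀ i)‖ * C) ^ w.mult with hE
  -- the product formula on the line bounds the expansion
  have key : ∀ t ≥ T, 0 ≤ t → Real.exp t * Q ≤ E := by
    intro t ht ht0
    obtain ⟨k, hk, hpar, hs⟩ := h t ht
    have hki : k i ≠ 0 := by
      intro h0
      obtain ⟨i', hi'⟩ := ne_zero_iff_entry.1 hk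
      fin_cases i <;> fin_cases i' <;> simp_all
    have hvec : k₀ i • k = k i • k₀ := by
      funext a
      fin_cases i <;> fin_cases a <;> simp only [Fin.zero_eta, Fin.mk_one, Pi.smul_apply,
        smul_eq_mul] <;> first | ring1 | linear_combination hpar | linear_combination -hpar
    have hloc : ∀ w, ‖emb w (k i)‖ * ‖act (flow v j t * g) k₀ w (r w)‖ ≤
        ‖emb w (k₀ i)‖ * C := by
      intro w
      rw [← norm_mul, ← act_smul, ← hvec, act_smul, norm_mul]
      exact mul_le_mul_of_nonneg_left (hs w _).le (norm_nonneg _)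
    have hflow : Real.exp t ≤ ∏ w : InfinitePlace K, ‖flow v j t w (r w) (r w)‖ ^ w.mult := by
      rw [Finset.prod_eq_single v]
      · simp only [r, if_true, norm_flow_self]
        exact le_self_pow₀ (Real.one_le_exp ht0) v.mult_ne_zero
      · intro w _ hw
        rw [norm_flow_of_ne hw, one_pow]
      · simp
    calc Real.exp t * Q ≤ (∏ w : InfinitePlace K, ‖flow v j t w (r w) (r w)‖ ^ w.mult) * Q :=
          mul_le_mul_of_nonneg_right hflow hQ0.le
      _ ≤ (∏ w : InfinitePlace K, ‖emb w (k i)‖ ^ w.mult) *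
          ((∏ w : InfinitePlace K, ‖flow v j t w (r w) (r w)‖ ^ w.mult) * Q) :=
          le_mul_of_one_le_left (by positivity) (one_le_prod_norm_emb hki)
      _ = ∏ w : InfinitePlace K,
          (‖emb w (k i)‖ * ‖act (flow v j t * g) k₀ w (r w)‖) ^ w.mult := by
          rw [hQ, ← Finset.prod_mul_distrib, ← Finset.prod_mul_distrib]
          refine Finset.prod_congr rfl fun w _ => ?_
          rw [act_diag_mul (flow_mem_D v j t), norm_mul]
          ring
      _ ≤ E := Finset.prod_le_prod (fun _ _ => by positivity) fun w _ =>
          pow_le_pow_left₀ (by positivity) (hloc w) _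
  set t := max (max T 0) (E / Q) with ht
  have h1 := key t ((le_max_left _ _).trans (le_max_left _ _))
    ((le_max_right _ _).trans (le_max_left _ _))
  have h2 : E / Q ≤ t := le_max_right _ _
  rw [div_le_iff₀ hQ0] at h2
  have h3 := Real.add_one_le_exp t
  nlinarith

/-- If row `j` of `g_v` kills no nonzero vector, then there are arbitrarily large times at which
the lattice has two independent short vectors. -/
lemma exists_independent_short {g : G K} {v : InfinitePlace K} {j : Fin 2}
    (hv : ∀ k : Fin 2 → 𝓞 K, k ≠ 0 → act g k v j ≠ 0) :
    ∃ C : ℝ, 0 < C ∧ ∀ T : ℝ, ∃ t ≥ T, ∃ k l : Fin 2 → 𝓞 K, k 0 * l 1 - k 1 * l 0 ≠ 0 ∧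
      (∀ w i, ‖act (flow v j t * g) k w i‖ < C) ∧
      (∀ w i, ‖act (flow v j t * g) l w i‖ < C) := by
  obtain ⟨R, hR, hshort⟩ := exists_short_vector g
  refine ⟨R + 1, by positivity, fun T => ?_⟩
  by_contra! hcon
  let P : (Fin 2 → 𝓞 K) → Set ℝ := fun k =>
    {t | T < t ∧ ∀ w i, ‖act (flow v j t * g) k w i‖ < R + 1}
  have hPopen : ∀ k, IsOpen (P k) := by
    intro k
    have hc : ∀ w i, Continuous fun t => ‖act (flow v j t * g) k w i‖ := by
      intro w i
      simp only [act_diag_mul (flow_mem_D v j _)]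
      exact (((continuous_entry w i i).comp (continuous_flow v j)).mul continuous_const).norm
    have hP : P k = Set.Ioi T ∩ ⋂ w, ⋂ i, {t | ‖act (flow v j t * g) k w i‖ < R + 1} := by
      ext t
      simp [P]
    rw [hP]
    refine isOpen_Ioi.inter ?_
    exact isOpen_iInter_of_finite fun w => isOpen_iInter_of_finite fun i =>
      isOpen_lt (hc w i) continuous_const
  have hpar : ∀ t k l, t ∈ P k → t ∈ P l → k 0 * l 1 = k 1 * l 0 := by
    intro t k l hk hl
    by_contra hkl
    obtain ⟨w, i, hwi⟩ := hcon t hk.1.le k l (sub_ne_zero.2 hkl) hk.2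
    exact absurd (hl.2 w i) (not_lt.2 hwi)
  have hex : ∀ t, T < t → ∃ k, k ≠ 0 ∧ t ∈ P k := by
    intro t ht
    obtain ⟨k, hk, h⟩ := hshort _ (flow_mem_D v j t)
    exact ⟨k, hk, ht, fun w i => (h w i).trans_lt (lt_add_one R)⟩
  obtain ⟨k₀, hk₀, hT⟩ := hex (T + 1) (lt_add_one T)
  -- two disjoint open sets cover the half line: short vectors on the line of `k₀`, or off it
  let U : Set ℝ := ⋃ k ∈ {k : Fin 2 → 𝓞 K | k ≠ 0 ∧ k 0 * k₀ 1 = k 1 * k₀ 0}, P k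
  let V : Set ℝ := ⋃ k ∈ {k : Fin 2 → 𝓞 K | k ≠ 0 ∧ k 0 * k₀ 1 ≠ k 1 * k₀ 0}, P k
  have hUV : Set.Ioi T ⊆ U := by
    refine IsPreconnected.subset_left_of_subset_union
      (isOpen_biUnion fun k _ => hPopen k) (isOpen_biUnion fun k _ => hPopen k)
      (v := V) ?_ ?_ ?_ isPreconnected_Ioi
    · rw [Set.disjoint_left]
      intro t htU htV
      obtain ⟨k, ⟨hk, hkk⟩, hkt⟩ := Set.mem_iUnion₂.1 htU
      obtain ⟨l, ⟨-, hlk⟩, hlt⟩ := Set.mem_iUnion₂.1 htV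
      exact hlk (parallel_trans hk (hpar t k l hkt hlt) hkk)
    · intro t ht
      obtain ⟨k, hk, hkt⟩ := hex t ht
      by_cases hkk : k 0 * k₀ 1 = k 1 * k₀ 0
      · exact Or.inl (Set.mem_biUnion (x := k) ⟨hk, hkk⟩ hkt)
      · exact Or.inr (Set.mem_biUnion (x := k) ⟨hk, hkk⟩ hkt)
    · exact ⟨T + 1, lt_add_one T, Set.mem_biUnion (x := k₀) ⟨hk₀, mul_comm _ _⟩ hT⟩
  refine not_forall_short_on_line hk₀ (hv k₀ hk₀) (C := R + 1) (T := T + 1) ?_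
  intro t ht
  obtain ⟨k, ⟨hk, hkk⟩, hs⟩ := Set.mem_iUnion₂.1 (hUV (lt_of_lt_of_le (lt_add_one T) ht))
  exact ⟨k, hk, hkk, hs.2⟩

/-- Two bases of finite-index sublattices of `𝓞²` with the same determinant `δ` that are congruent
modulo `δ` differ by an element of `SL(2, 𝓞)`. -/
lemma exists_SL_of_congr {k l p q : Fin 2 → 𝓞 K} {δ : 𝓞 K} (hδ : δ ≠ 0)
    (hkl : k 0 * l 1 - k 1 * l 0 = δ) (hpq : p 0 * q 1 - p 1 * q 0 = δ)
    (hk : ∀ i, δ ∣ k i - p i) (hl : ∀ i, δ ∣ l i - q i) :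
    ∃ β : SL(2, 𝓞 K), (∀ i, δ * β i 0 = q 1 * k i - p 1 * l i) ∧
      ∀ i, δ * β i 1 = p 0 * l i - q 0 * k i := by
  choose x hx using hk
  choose y hy using hl
  have e0 := hx 0
  have e1 := hx 1
  have f0 := hy 0
  have f1 := hy 1
  have hβ0 : δ * (1 + q 1 * x 0 - p 1 * y 0) = q 1 * k 0 - p 1 * l 0 := by
    linear_combination -q 1 * e0 + p 1 * f0 - hpq
  have hβ1 : δ * (q 1 * x 1 - p 1 * y 1) = q 1 * k 1 - p 1 * l 1 := by
    linear_combination -q 1 * e1 + p 1 * f1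
  have hβ2 : δ * (p 0 * y 0 - q 0 * x 0) = p 0 * l 0 - q 0 * k 0 := by
    linear_combination -p 0 * f0 + q 0 * e0
  have hβ3 : δ * (1 + p 0 * y 1 - q 0 * x 1) = p 0 * l 1 - q 0 * k 1 := by
    linear_combination -p 0 * f1 + q 0 * e1 - hpq
  refine ⟨⟨!![1 + q 1 * x 0 - p 1 * y 0, p 0 * y 0 - q 0 * x 0;
    q 1 * x 1 - p 1 * y 1, 1 + p 0 * y 1 - q 0 * x 1], ?_⟩, ?_, ?_⟩
  · rw [Matrix.det_fin_two_of]
    refine mul_left_cancel₀ (mul_ne_zero hδ hδ) ?_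
    calc _ = (δ * (1 + q 1 * x 0 - p 1 * y 0)) * (δ * (1 + p 0 * y 1 - q 0 * x 1)) -
          (δ * (p 0 * y 0 - q 0 * x 0)) * (δ * (q 1 * x 1 - p 1 * y 1)) := by ring
      _ = (k 0 * l 1 - k 1 * l 0) * (p 0 * q 1 - p 1 * q 0) := by
        rw [hβ0, hβ1, hβ2, hβ3]; ring
      _ = δ * δ * 1 := by rw [hkl, hpq]; ring
  · intro i
    fin_cases i
    · exact hβ0
    · exact hβ1
  · intro i
    fin_cases i
    · exact hβ2
    · exact hβ3

/-- If row `j` of `g_v` kills no nonzero vector, the translates of `π(g)` by `D_v` return to a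
compact set at arbitrarily large times. -/
lemma exists_compact_return {g : G K} {v : InfinitePlace K} {j : Fin 2}
    (hv : ∀ k : Fin 2 → 𝓞 K, k ≠ 0 → act g k v j ≠ 0) :
    ∃ Q : Set (Space K), IsCompact Q ∧ ∀ T : ℝ, ∃ t ≥ T, flow v j t • proj K g ∈ Q := by
  obtain ⟨C, hC, h⟩ := exists_independent_short hv
  choose t ht k l hkl hk hl using fun n : ℕ => h n
  let δ : ℕ → 𝓞 K := fun n => k n 0 * l n 1 - k n 1 * l n 0
  have hδle : ∀ n, δ n ∈ {x : 𝓞 K | ∀ v : InfinitePlace K, ‖emb v x‖ ≤ 2 * C * C} := by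
    intro n w
    rw [← act_det (flow v j (t n) * g)]
    refine (norm_sub_le _ _).trans ?_
    rw [norm_mul, norm_mul]
    have := mul_le_mul (hk n w 0).le (hl n w 1).le (norm_nonneg _) hC.le
    have := mul_le_mul (hk n w 1).le (hl n w 0).le (norm_nonneg _) hC.le
    linarith
  obtain ⟨d, -, hd⟩ := Ultrafilter.eq_pure_of_finite_mem (finite_norm_emb_le (2 * C * C))
    (f := (hyperfilter ℕ).map δ) (Ultrafilter.mem_map.2 (Filter.univ_mem' hδle))
  have hd' : ∀ᶠ n in (hyperfilter ℕ : Filter ℕ), δ n = d := by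
    have : ({d} : Set (𝓞 K)) ∈ (hyperfilter ℕ).map δ := by rw [hd]; exact Ultrafilter.mem_pure.2 rfl
    exact this
  have hd0 : d ≠ 0 := by
    obtain ⟨n, hn⟩ := hd'.exists
    exact hn ▸ hkl n
  have hfin : Finite (𝓞 K ⧸ Ideal.span {d}) :=
    Ideal.finiteQuotientOfFreeOfNeBot _ (by simpa using hd0)
  let ρ : ℕ → (Fin 2 → 𝓞 K ⧸ Ideal.span {d}) × (Fin 2 → 𝓞 K ⧸ Ideal.span {d}) := fun n =>
    (fun i => Ideal.Quotient.mk _ (k n i), fun i => Ideal.Quotient.mk _ (l n i))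
  obtain ⟨c, hc⟩ := Ultrafilter.eq_pure_of_finite ((hyperfilter ℕ).map ρ)
  have hc' : ∀ᶠ n in (hyperfilter ℕ : Filter ℕ), ρ n = c := by
    have : {c} ∈ (hyperfilter ℕ).map ρ := by rw [hc]; exact Ultrafilter.mem_pure.2 rfl
    exact this
  obtain ⟨m, hmd, hmc⟩ := (hd'.and hc').exists
  obtain ⟨B, hB⟩ : ∃ B : ℝ, ∀ w i, ‖emb w (k m i)‖ * C + ‖emb w (l m i)‖ * C ≤ B * ‖emb w d‖ := by
    refine ⟨∑ w, ∑ i, (‖emb w (k m i)‖ * C + ‖emb w (l m i)‖ * C) / ‖emb w d‖, fun w i => ?_⟩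
    rw [← div_le_iff₀ (norm_pos_iff.2 (emb_ne_zero w hd0))]
    refine (Finset.single_le_sum (f := fun i => (‖emb w (k m i)‖ * C + ‖emb w (l m i)‖ * C) /
      ‖emb w d‖) (fun _ _ => by positivity) (Finset.mem_univ i)).trans ?_
    exact Finset.single_le_sum (f := fun w : InfinitePlace K => ∑ i,
      (‖emb w (k m i)‖ * C + ‖emb w (l m i)‖ * C) / ‖emb w d‖)
      (fun _ _ => by positivity) (Finset.mem_univ w)
  refine ⟨proj K '' {z : G K | ∀ v i j, ‖z v i j‖ ≤ B},
    (isCompact_entries_le B).image QuotientGroup.continuous_mk, fun T => ?_⟩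
  have hT : ∀ᶠ n : ℕ in (hyperfilter ℕ : Filter ℕ), T ≤ n :=
    Nat.hyperfilter_le_atTop (tendsto_natCast_atTop_atTop.eventually_ge_atTop T)
  obtain ⟨n, hnd, hnc, hnT⟩ := (hd'.and (hc'.and hT)).exists
  have hρ : ρ n = ρ m := hnc.trans hmc.symm
  have hcong : (∀ i, d ∣ k n i - k m i) ∧ ∀ i, d ∣ l n i - l m i := by
    constructor <;> intro i <;> rw [← Ideal.mem_span_singleton, ← Ideal.Quotient.eq]
    · exact congrFun (congrArg Prod.fst hρ) i
    · exact congrFun (congrArg Prod.snd hρ) i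
  obtain ⟨β, hβ0, hβ1⟩ := exists_SL_of_congr hd0 hnd hmd hcong.1 hcong.2
  refine ⟨t n, hnT.trans (ht n), flow v j (t n) * g * diagonalEmbedding K β, ?_, ?_⟩
  · have hentry : ∀ w i c, emb w d * (flow v j (t n) * g * diagonalEmbedding K β) w i c =
        (flow v j (t n) * g) w i 0 * emb w (d * β 0 c) +
          (flow v j (t n) * g) w i 1 * emb w (d * β 1 c) := by
      intro w i c
      rw [Pi.mul_apply, Matrix.SpecialLinearGroup.coe_mul, Matrix.mul_apply, Fin.sum_univ_two,
        diagonalEmbedding_apply, diagonalEmbedding_apply, map_mul, map_mul]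
      ring
    have hbound : ∀ w i (x y : 𝓞 K), ‖emb w x * act (flow v j (t n) * g) (k n) w i -
        emb w y * act (flow v j (t n) * g) (l n) w i‖ ≤ ‖emb w y‖ * C + ‖emb w x‖ * C := by
      intro w i x y
      refine (norm_sub_le _ _).trans ?_
      rw [norm_mul, norm_mul, add_comm]
      exact add_le_add (mul_le_mul_of_nonneg_left (hl n w i).le (norm_nonneg _))
        (mul_le_mul_of_nonneg_left (hk n w i).le (norm_nonneg _))
    intro w i c
    refine le_of_mul_le_mul_left ?_ (norm_pos_iff.2 (emb_ne_zero w hd0))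
    rw [← norm_mul, hentry, mul_comm _ B]
    fin_cases c
    · refine le_trans (le_of_eq ?_) ((hbound w i (l m 1) (k m 1)).trans (hB w 1))
      simp only [Fin.zero_eta, hβ0, act, map_sub, map_mul]
      congr 1
      ring
    · refine le_trans (le_of_eq ?_) ((hbound w i (l m 0) (k m 0)).trans (hB w 0))
      simp only [Fin.mk_one, hβ1, act, map_sub, map_mul]
      rw [← norm_neg]
      congr 1
      ring
  · rw [smul_proj]
    exact (proj_eq_iff.2 ⟨β, by group⟩).symm

/-- Locally divergent points are rational. -/
lemma rational_of_isLocallyDivergent {g : G K} (hg : IsLocallyDivergent (proj K g)) :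
    Rational g := by
  intro v j
  by_contra! hv
  obtain ⟨Q, hQ, h⟩ := exists_compact_return hv
  have hc := (hg v).isCompact_preimage hQ
  have hcont : Continuous fun a : factor v => ‖(a : G K) v j j‖ :=
    ((continuous_entry v j j).comp continuous_subtype_val).norm
  obtain ⟨B, hB⟩ := hc.bddAbove_image hcont.continuousOn
  obtain ⟨t, ht, htQ⟩ := h (B + 1)
  have h1 := hB ⟨⟨flow v j t, flow_mem_factor v j t⟩, htQ, rfl⟩
  simp only [norm_flow_self] at h1
  linarith [Real.add_one_le_exp t]

/-! ### Normalizing the torus -/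

/-- An element conjugating a regular diagonal matrix into a diagonal matrix normalizes the
diagonal group: conjugation is trivial or the inversion. -/
lemma conj_eq_or_inv {L : Type*} [Field L] {f b e : SL(2, L)} (hb : b ∈ diagonalSubgroup L)
    (he : e ∈ diagonalSubgroup L) (hreg : b 0 0 ≠ b 1 1) (h : b * f = f * e) {d : SL(2, L)}
    (hd : d ∈ diagonalSubgroup L) : f * d = d * f ∨ f * d = d⁻¹ * f := by
  have hent : ∀ i j, b i i * f i j = f i j * e j j := by
    intro i j
    have := congrArg (fun A : SL(2, L) => A i j) h
    simp only [Matrix.SpecialLinearGroup.coe_mul, Matrix.mul_apply, Fin.sum_univ_two] at this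
    obtain ⟨hb1, hb2⟩ := hb
    obtain ⟨he1, he2⟩ := he
    fin_cases i <;> fin_cases j <;> simpa [hb1, hb2, he1, he2] using this
  have hcol : ∀ j, f 0 j = 0 ∨ f 1 j = 0 := by
    intro j
    by_contra! hne
    refine hreg ?_
    have h0 : b 0 0 = e j j := mul_right_cancel₀ hne.1 (by rw [hent, mul_comm])
    have h1 : b 1 1 = e j j := mul_right_cancel₀ hne.2 (by rw [hent, mul_comm])
    rw [h0, h1]
  have hdet := f.det_coe
  rw [Matrix.det_fin_two] at hdet
  obtain ⟨hd1, hd2⟩ := hd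
  rcases hcol 0 with h0 | h0
  · right
    have h11 : f 1 1 = 0 := by
      rcases hcol 1 with h1 | h1
      · simp [h0, h1] at hdet
      · exact h1
    refine Matrix.SpecialLinearGroup.ext _ _ fun i j => ?_
    simp only [Matrix.SpecialLinearGroup.coe_mul, Matrix.mul_apply, Fin.sum_univ_two,
      Matrix.SpecialLinearGroup.coe_inv, Matrix.adjugate_fin_two]
    fin_cases i <;> fin_cases j <;> simp [h0, h11, hd1, hd2, mul_comm]
  · left
    have h01 : f 0 1 = 0 := by
      rcases hcol 1 with h1 | h1
      · exact h1
      · simp [h0, h1] at hdet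
    refine Matrix.SpecialLinearGroup.ext _ _ fun i j => ?_
    simp only [Matrix.SpecialLinearGroup.coe_mul, Matrix.mul_apply, Fin.sum_univ_two]
    fin_cases i <;> fin_cases j <;> simp [h0, h01, hd1, hd2, mul_comm]

lemma smul_orbitD_subset {f b e : G K} (hb : b ∈ D K) (he : e ∈ D K)
    (hreg : ∀ v, b v 0 0 ≠ b v 1 1) (h : b * f = f * e) {p y : Space K} (hy : y ∈ orbitD p) :
    f • y ∈ orbitD (f • p) := by
  classical
  obtain ⟨d, rfl⟩ := hy
  have hconj : ∀ v, f v * (d : G K) v = (d : G K) v * f v ∨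
      f v * (d : G K) v = ((d : G K) v)⁻¹ * f v := fun v =>
    conj_eq_or_inv (torusAt_le v (mem_D_iff.1 hb v)) (torusAt_le v (mem_D_iff.1 he v)) (hreg v)
      (congrFun h v) (torusAt_le v (mem_D_iff.1 d.2 v))
  have hd' : ∀ v, ∃ c ∈ torusAt v, f v * (d : G K) v = c * f v := by
    intro v
    rcases hconj v with h | h
    · exact ⟨_, mem_D_iff.1 d.2 v, h⟩
    · exact ⟨_, inv_mem (mem_D_iff.1 d.2 v), h⟩
  choose c hc hfc using hd'
  refine ⟨⟨c, mem_D_iff.2 hc⟩, ?_⟩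
  have hfd : f * (d : G K) = c * f := funext hfc
  change c • f • p = f • (d : G K) • p
  rw [smul_smul, smul_smul, hfd]

/-! ### The orbit measure -/

/-- The element of the real torus `D_ℝ` with entry `e ^ t` in the first row at every place. -/
noncomputable def realFlow (t : ℝ) : G K := fun v => diagSL 0 (expAt v t)

lemma realFlow_mem_realD (t : ℝ) : (realFlow t : G K) ∈ realD K := by
  simp only [realD, Subgroup.mem_pi]
  exact fun v _ => diagSL_expAt_mem_realTorusAt v 0 t

lemma realFlow_mem_D (t : ℝ) : (realFlow t : G K) ∈ D K :=
  mem_D_iff.2 fun v => diagSL_expAt_mem_torusAt v 0 t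

lemma continuous_realFlow : Continuous (realFlow : ℝ → G K) :=
  continuous_pi fun v => continuous_diagSL 0 (continuous_expAt v)

lemma logEntry_realFlow (t : ℝ) (v : InfinitePlace K) : logEntry (realFlow t : G K) v 0 = t := by
  simp [logEntry, realFlow, norm_expAt]

/-- If `f` conjugates the flow `realFlow` so that small times map `π(g)` into its own orbit, then
two distinct times lead to the same element of the countable group `SL(2, 𝓞)`; their quotient
shows that `f` normalizes the torus. -/
lemma exists_regular_conj {f g : G K} {ε : ℝ} (hε : 0 < ε)
    (h : ∀ t ∈ Set.Ioo 0 ε, (f⁻¹ * realFlow t * (f : G K)) • proj K g ∈ orbitD (proj K g)) :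
    ∃ b ∈ D K, ∃ e ∈ D K, (∀ v, b v 0 0 ≠ b v 1 1) ∧ b * f = f * e := by
  have hγ : ∀ t : Set.Ioo 0 ε, ∃ d ∈ D K, ∃ γ : SL(2, 𝓞 K),
      f⁻¹ * realFlow (t : ℝ) * f * g = d * g * diagonalEmbedding K γ := by
    rintro ⟨t, ht⟩
    obtain ⟨d, hd⟩ := h t ht
    obtain ⟨γ, hγ⟩ := exists_eq_mul_of_proj_eq (a := (d : G K) * g)
      (b := f⁻¹ * realFlow t * f * g) hd
    exact ⟨d, d.2, γ, hγ⟩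
  choose d hd γ hγ using hγ
  have hunc : ¬ Countable (Set.Ioo (0 : ℝ) ε) := by
    rw [Set.countable_coe_iff]
    exact fun hc => (Cardinal.Real.Ioo_countable_iff.1 hc).not_gt hε
  have hcount : Countable SL(2, 𝓞 K) :=
    Function.Injective.countable (f := fun (A : SL(2, 𝓞 K)) (i j : Fin 2) => A i j)
      fun A B h => Matrix.SpecialLinearGroup.ext _ _ fun i j => congrFun (congrFun h i) j
  have hninj : ¬ Function.Injective γ := fun hi => hunc hi.countable
  simp only [Function.Injective, not_forall] at hninj
  obtain ⟨t, t', heq, hne⟩ := hninj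
  have h1 := hγ t
  have h2 := hγ t'
  rw [← heq] at h2
  refine ⟨realFlow (t : ℝ) * (realFlow (t' : ℝ))⁻¹,
    mul_mem (realFlow_mem_D _) (inv_mem (realFlow_mem_D _)), d t * (d t')⁻¹,
    mul_mem (hd t) (inv_mem (hd t')), ?_, ?_⟩
  · intro v hv
    have hb : realFlow (t : ℝ) * (realFlow (t' : ℝ))⁻¹ ∈ D K :=
      mul_mem (realFlow_mem_D _) (inv_mem (realFlow_mem_D _))
    have h3 := logEntry_other hb v 0
    have h4 : logEntry (realFlow (t : ℝ) * (realFlow (t' : ℝ))⁻¹) v 0 = t - t' := by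
      rw [logEntry_mul (realFlow_mem_D _) (inv_mem (realFlow_mem_D _)),
        logEntry_inv (realFlow_mem_D _), logEntry_realFlow, logEntry_realFlow]
      ring
    have h5 : logEntry (realFlow (t : ℝ) * (realFlow (t' : ℝ))⁻¹) v (1 - 0) =
        logEntry (realFlow (t : ℝ) * (realFlow (t' : ℝ))⁻¹) v 0 := by
      simp only [logEntry, sub_zero, hv]
    rw [h5, h4] at h3
    exact hne (Subtype.ext (by linarith))
  · have e1 : d t = f⁻¹ * realFlow (t : ℝ) * f * g * (diagonalEmbedding K (γ t))⁻¹ * g⁻¹ := by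
      rw [h1]; group
    have e2 : d t' = f⁻¹ * realFlow (t' : ℝ) * f * g * (diagonalEmbedding K (γ t))⁻¹ * g⁻¹ := by
      rw [h2]; group
    rw [e1, e2]
    group

/-- A measure concentrated on an orbit with closed nonempty boundary, and supported on its closure,
is not algebraic: a group acting transitively on the support would contain an `f` moving the orbit
to its boundary, `f` would normalize `D`, and the whole orbit would be moved to a null set. -/
lemma not_isAlgebraic_of_support {g : G K} {μ : Measure (Space K)}
    (hcl : IsClosed (closure (orbitD (proj K g)) \ orbitD (proj K g)))
    (hne : (closure (orbitD (proj K g)) \ orbitD (proj K g)).Nonempty)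
    (hAmeas : MeasurableSet (orbitD (proj K g))) (hAc : μ (orbitD (proj K g))ᶜ = 0)
    (hA0 : μ (orbitD (proj K g)) ≠ 0) (hsupp : μ.support = closure (orbitD (proj K g))) :
    ¬ IsAlgebraic μ := by
  set p := proj K g with hp
  set A := orbitD p with hA
  rintro ⟨F, -, hDF, hinv, x, hx⟩
  obtain ⟨q, hqcl, hqA⟩ := hne
  have hpF : p ∈ MulAction.orbit F x := by
    rw [← hx, hsupp]
    exact subset_closure (MulAction.mem_orbit_self p)
  have hqF : q ∈ MulAction.orbit F p := by
    rw [MulAction.orbit_eq_iff.2 hpF, ← hx, hsupp]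
    exact hqcl
  obtain ⟨f, hf⟩ := hqF
  -- for small times the conjugated flow keeps `p` in its orbit, as the boundary is closed
  have hmem : ∀ t : ℝ, ((f : G K)⁻¹ * realFlow t * (f : G K)) • p ∈ closure A := by
    intro t
    have h1 : (f : G K)⁻¹ * realFlow t * (f : G K) ∈ F :=
      mul_mem (mul_mem (inv_mem f.2) (hDF (realFlow_mem_realD t))) f.2
    rw [← hsupp, hx, ← MulAction.orbit_eq_iff.2 hpF]
    exact ⟨⟨_, h1⟩, rfl⟩
  have hcont : Continuous fun t : ℝ => ((f : G K)⁻¹ * realFlow t * (f : G K)) • p := by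
    have h1 : Continuous fun t : ℝ => (f : G K)⁻¹ * realFlow t * (f : G K) :=
      (continuous_const.mul continuous_realFlow).mul continuous_const
    exact h1.smul (continuous_const (y := p))
  have h0 : ((f : G K)⁻¹ * realFlow 0 * (f : G K)) • p ∉ closure A \ A := by
    have : (realFlow 0 : G K) = 1 := by
      funext v
      simp [realFlow, expAt_zero, diagSL_one]
    rw [this, mul_one, inv_mul_cancel, one_smul]
    exact fun h => h.2 (MulAction.mem_orbit_self p)
  obtain ⟨ε, hε, hball⟩ := Metric.mem_nhds_iff.1
    (hcont.continuousAt.preimage_mem_nhds (hcl.isOpen_compl.mem_nhds h0))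
  obtain ⟨b, hb, e, he, hreg, hbf⟩ := exists_regular_conj (f := (f : G K)) (g := g) hε
    (fun t ht => by
      have h1 := hball (show t ∈ Metric.ball (0 : ℝ) ε by
        rw [mem_ball_zero_iff, Real.norm_eq_abs, abs_of_pos ht.1]; exact ht.2)
      by_contra h2
      exact h1 ⟨hmem t, h2⟩)
  have hfA : A ⊆ (fun y : Space K => f • y) ⁻¹' Aᶜ := by
    intro y hy hyA
    have h1 : f • y ∈ orbitD (f • p) := smul_orbitD_subset hb he hreg hbf hy
    have h2 : f • p = q := hf
    rw [h2] at h1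
    refine hqA ?_
    rw [hA, ← orbitD_eq_of_mem hyA, orbitD_eq_of_mem h1]
    exact MulAction.mem_orbit_self q
  refine hA0 (measure_mono_null hfA ?_)
  rw [hinv.measure_preimage_smul f hAmeas.compl, hAc]

/-- An orbit with compact stabilizer whose boundary is closed and nonempty carries a `σ`-finite
ergodic measure that is not algebraic: the image of Haar measure on `D`. -/
theorem exists_nonalgebraic_measure {g : G K}
    (hcl : IsClosed (closure (orbitD (proj K g)) \ orbitD (proj K g)))
    (hne : (closure (orbitD (proj K g)) \ orbitD (proj K g)).Nonempty)
    (hst : ∀ d : D K, d • proj K g = proj K g → ∀ v, |logEntry (d : G K) v 0| ≤ 0) :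
    ∃ μ : Measure (Space K), μ ≠ 0 ∧ SigmaFinite μ ∧ ErgodicSMul (D K) (Space K) μ ∧
      ¬ IsAlgebraic μ := by
  set p := proj K g with hp
  have : LocallyCompactSpace (D K) := isClosed_D.isClosedEmbedding_subtypeVal.locallyCompactSpace
  have : SecondCountableTopology (D K) := 
    IsEmbedding.subtypeVal.secondCountableTopology
  borelize ↥(D K)
  let ν : Measure (D K) := Measure.haar
  let o : D K → Space K := fun d => d • p
  have ho : Continuous o := by fun_prop
  have hom : Measurable o := ho.measurable
  set A := orbitD p with hA
  have hAdiff : A = closure A \ (closure A \ A) := by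
    rw [Set.sdiff_sdiff_cancel_left subset_closure]
  have hAmeas : MeasurableSet A := by
    rw [hAdiff]
    exact isClosed_closure.measurableSet.diff hcl.measurableSet
  have hoA : ∀ d, o d ∈ A := fun d => ⟨d, rfl⟩
  let μ := ν.map o
  have hAc : μ Aᶜ = 0 := by
    rw [Measure.map_apply hom hAmeas.compl]
    convert! measure_empty (μ := ν)
    ext d
    simp [hoA]
  have hA0 : μ A ≠ 0 := by
    rw [Measure.map_apply hom hAmeas]
    have : o ⁻¹' A = Set.univ := Set.eq_univ_of_forall hoA
    rw [this]
    exact (Measure.measure_univ_pos.2 (NeZero.ne ν)).ne'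
  have hsupp : μ.support = closure A := by
    refine Set.Subset.antisymm ?_ (closure_minimal ?_ Measure.isClosed_support)
    · intro x hx
      by_contra hxA
      refine ((Measure.mem_support_iff_forall x).1 hx _
        (isClosed_closure.isOpen_compl.mem_nhds hxA)).ne' ?_
      exact measure_mono_null (Set.compl_subset_compl.2 subset_closure) hAc
    · rintro _ ⟨d, rfl⟩
      refine (Measure.mem_support_iff_forall _).2 fun U hU => ?_
      refine lt_of_lt_of_le ?_ (Measure.le_map_apply hom.aemeasurable U)
      exact ν.measure_pos_of_mem_nhds (ho.continuousAt.preimage_mem_nhds hU)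
  refine ⟨μ, ?_, ?_, ?_, ?_⟩
  · intro h0
    exact hA0 (by rw [h0]; rfl)
  · -- the images of a compact exhaustion of `D`, whose preimages lie in compact sets
    have hcomp : ∀ n, IsCompact (o '' compactCovering (D K) n) := fun n =>
      (isCompact_compactCovering (D K) n).image ho
    have hfin : ∀ n, μ (o '' compactCovering (D K) n ∪ Aᶜ) < ⊤ := by
      intro n
      refine (measure_union_le _ _).trans_lt ?_
      rw [hAc, add_zero, Measure.map_apply hom (hcomp n).isClosed.measurableSet]
      refine lt_of_le_of_lt (measure_mono ?_)
        ((isCompact_compactCovering (D K) n).mul (isCompact_logEntry_le 0)).measure_lt_top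
      rintro d ⟨c, hc, hcd⟩
      refine ⟨c, hc, c⁻¹ * d, hst _ ?_, by simp⟩
      rw [mul_smul]
      exact inv_smul_eq_iff.2 hcd.symm
    refine ⟨⟨⟨fun n => o '' compactCovering (D K) n ∪ Aᶜ, fun _ => trivial, hfin, ?_⟩⟩⟩
    refine Set.eq_univ_of_forall fun x => ?_
    by_cases hx : x ∈ A
    · obtain ⟨d, rfl⟩ := hx
      have hd : d ∈ ⋃ n, compactCovering (D K) n := by
        rw [iUnion_compactCovering]; trivial
      obtain ⟨n, hn⟩ := Set.mem_iUnion.1 hd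
      exact Set.mem_iUnion.2 ⟨n, Or.inl ⟨d, hn, rfl⟩⟩
    · exact Set.mem_iUnion.2 ⟨0, Or.inr hx⟩
  · have hpre : ∀ (c : D K) (s : Set (Space K)),
        o ⁻¹' ((fun x => c • x) ⁻¹' s) = (fun d => c * d) ⁻¹' (o ⁻¹' s) := by
      intro c s
      ext d
      simp [o, mul_smul]
    have hq : Measure.QuasiMeasurePreserving o ν μ := ⟨hom, Measure.AbsolutelyContinuous.rfl⟩
    refine @ErgodicSMul.mk _ _ _ _ _ ⟨fun c s hs => ?_⟩ (fun {s} hs hinv => ?_)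
    · have hcs : MeasurableSet ((fun x : Space K => c • x) ⁻¹' s) :=
        hs.preimage (continuous_const_smul c).measurable
      rw [Measure.map_apply hom hcs, Measure.map_apply hom hs, hpre]
      exact measure_preimage_mul ν c _
    · have h1 : EventuallyConst (o ⁻¹' s) (ae ν) := by
        refine aeconst_of_forall_preimage_smul_ae_eq (D K)
          (hs.preimage hom).nullMeasurableSet fun c => ?_
        have := hq.preimage_ae_eq (hinv c)
        rw [hpre] at this
        exact this
      rw [eventuallyConst_set] at h1 ⊢
      rcases h1 with h1 | h1
      · left
        exact (ae_map_iff hom.aemeasurable hs).2 h1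
      · right
        exact (ae_map_iff hom.aemeasurable hs.compl).2 h1
  · exact not_isAlgebraic_of_support hcl hne hAmeas hAc hA0 hsupp

/-! ### A non-closed rational orbit -/

open scoped Classical in
/-- The element with component `1` at `v₁` and a unipotent matrix at the other places. -/
noncomputable def unipotentPoint (v₁ : InfinitePlace K) : G K := fun v =>
  if v = v₁ then 1 else shear 1 1

section unipotentPoint

variable {v₁ v : InfinitePlace K}

lemma act_unipotentPoint_self (k : Fin 2 → 𝓞 K) (j : Fin 2) :
    act (unipotentPoint v₁) k v₁ j = emb v₁ (k j) := by
  revert j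
  simp [Fin.forall_fin_two, act, unipotentPoint]

lemma act_unipotentPoint_zero (hv : v ≠ v₁) (k : Fin 2 → 𝓞 K) :
    act (unipotentPoint v₁) k v 0 = emb v (k 0 + k 1) := by
  simp [act, unipotentPoint, hv, shear_apply]

lemma act_unipotentPoint_one (hv : v ≠ v₁) (k : Fin 2 → 𝓞 K) :
    act (unipotentPoint v₁) k v 1 = emb v (k 1) := by
  simp [act, unipotentPoint, hv, shear_apply]

lemma rational_unipotentPoint : Rational (unipotentPoint v₁) := by
  intro v j
  by_cases hv : v = v₁
  · subst hv
    fin_cases j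
    · exact ⟨![0, 1], by simp, by simp [act_unipotentPoint_self]⟩
    · exact ⟨![1, 0], by simp, by simp [act_unipotentPoint_self]⟩
  · fin_cases j
    · exact ⟨![1, -1], by simp, by simp [act_unipotentPoint_zero hv]⟩
    · exact ⟨![1, 0], by simp, by simp [act_unipotentPoint_one hv]⟩

lemma CommonKill.unipotentPoint {v₂ : InfinitePlace K} (hne : v₂ ≠ v₁)
    {σ : InfinitePlace K → Fin 2} (h : CommonKill (unipotentPoint v₁) σ) : σ v₁ = 1 := by
  obtain ⟨k, hk, h⟩ := h
  by_contra hσ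
  have h0 : σ v₁ = 0 := by rw [eq_other hσ, sub_self]
  have h1 := h v₁
  rw [act_unipotentPoint_self, emb_eq_zero_iff, h0] at h1
  have h2 := h v₂
  have h3 : k 1 = 0 := by
    by_cases hs : σ v₂ = 0
    · rw [hs, act_unipotentPoint_zero hne, emb_eq_zero_iff, h1, zero_add] at h2
      exact h2
    · rw [eq_other hs, sub_zero, act_unipotentPoint_one hne, emb_eq_zero_iff] at h2
      exact h2
  refine hk (funext fun i => ?_)
  fin_cases i
  · exact h1
  · exact h3

lemma stabilizer_unipotentPoint {v₂ : InfinitePlace K} (hne : v₂ ≠ v₁) {d : D K}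
    (h : d • proj K (unipotentPoint v₁) = proj K (unipotentPoint v₁)) (v : InfinitePlace K) :
    |logEntry (d : G K) v 0| ≤ 0 := by
  obtain ⟨γ, hγ⟩ := exists_eq_mul_of_proj_eq (a := unipotentPoint v₁)
    (b := (d : G K) * unipotentPoint v₁) h.symm
  have hact : ∀ (k : Fin 2 → 𝓞 K) v j, (d : G K) v j j * act (unipotentPoint v₁) k v j =
      act (unipotentPoint v₁) (γ.1.mulVec k) v j := by
    intro k v j
    rw [← act_diag_mul d.2, hγ, act_mul_diagonalEmbedding]
  have hm : ∀ (k : Fin 2 → 𝓞 K) i, γ.1.mulVec k i = γ i 0 * k 0 + γ i 1 * k 1 := by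
    intro k i
    simp [Matrix.mulVec, dotProduct, Fin.sum_univ_two]
  have h01 : γ 0 1 = 0 := by
    have := hact ![0, 1] v₁ 0
    rw [act_unipotentPoint_self, act_unipotentPoint_self, hm] at this
    simpa [emb_eq_zero_iff] using this.symm
  have h10 : γ 1 0 = 0 := by
    have := hact ![1, 0] v₁ 1
    rw [act_unipotentPoint_self, act_unipotentPoint_self, hm] at this
    simpa [emb_eq_zero_iff] using this.symm
  have h00 : γ 0 0 - γ 1 1 = 0 := by
    have := hact ![1, -1] v₂ 0
    rw [act_unipotentPoint_zero hne, act_unipotentPoint_zero hne, hm, hm] at this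
    simp only [Matrix.cons_val_zero, Matrix.cons_val_one, h01, h10] at this
    rw [← emb_eq_zero_iff v₂]
    simpa [sub_eq_add_neg] using this.symm
  have hdet := γ.det_coe
  rw [Matrix.det_fin_two, h01, ← sub_eq_zero.1 h00] at hdet
  have hd : (d : G K) v 0 0 = emb v (γ 0 0) := by
    have := hact ![1, 0] v 0
    by_cases hv : v = v₁
    · subst hv
      rw [act_unipotentPoint_self, act_unipotentPoint_self, hm] at this
      simpa using this
    · rw [act_unipotentPoint_zero hv, act_unipotentPoint_zero hv, hm, hm] at this
      simpa [h10] using this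
  have hnorm : ‖emb v (γ 0 0)‖ = 1 := by
    have h2 : emb v (γ 0 0) * emb v (γ 0 0) = 1 := by
      rw [← map_mul]
      simpa using congrArg (emb v) hdet
    have h3 := congrArg norm h2
    rw [norm_mul, norm_one] at h3
    nlinarith [norm_nonneg (emb v (γ 0 0))]
  rw [logEntry, hd, hnorm, Real.log_one, abs_zero]

end unipotentPoint

end HilbertModular

theorem corollary1 (K : Type*) [Field K] [NumberField K]
    (hr : Fintype.card (NumberField.InfinitePlace K) = 2) :
    (∀ g : HilbertModular.G K,
      HilbertModular.IsLocallyDivergent (HilbertModular.proj K g) →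
      IsClosed (HilbertModular.orbitD (HilbertModular.proj K g)) ∨
      ∃ s : ℕ, 2 ≤ s ∧ s ≤ 4 ∧ ∃ h : Fin s → HilbertModular.G K,
        closure (HilbertModular.orbitD (HilbertModular.proj K g)) \
            HilbertModular.orbitD (HilbertModular.proj K g) =
          ⋃ i, HilbertModular.orbitD (HilbertModular.proj K (h i)) ∧
        (Pairwise fun i j => HilbertModular.orbitD (HilbertModular.proj K (h i)) ≠
          HilbertModular.orbitD (HilbertModular.proj K (h j))) ∧
        ∀ i, IsClosed (HilbertModular.orbitD (HilbertModular.proj K (h i))) ∧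
          ¬ IsCompact (HilbertModular.orbitD (HilbertModular.proj K (h i)))) ∧
    (∃ μ : MeasureTheory.Measure (HilbertModular.Space K),
      μ ≠ 0 ∧ MeasureTheory.SigmaFinite μ ∧
      ErgodicSMul (HilbertModular.D K) (HilbertModular.Space K) μ ∧
      ¬ HilbertModular.IsAlgebraic μ) := by
  open HilbertModular in
  refine ⟨fun g hg => ?_, ?_⟩
  · have hrat := rational_of_isLocallyDivergent hg
    by_cases hm : ∃ σ, CommonKill g σ ∧ CommonKill g (1 - σ)
    · obtain ⟨σ, hσ⟩ := hm
      obtain ⟨a, b, hab⟩ := exists_matched_iff.2 hσ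
      exact Or.inl (hab.isClosed_orbit hr)
    · exact Or.inr (boundary_of_not_matched hrat hr (not_exists.1 hm))
  · obtain ⟨v₁, v₂, hne, -⟩ := exists_places hr
    obtain ⟨s, hs, -, h, hb, -, hcl⟩ := boundary_of_not_matched
      (rational_unipotentPoint (v₁ := v₁)) hr fun σ hσ => by
        have h1 := hσ.1.unipotentPoint hne.symm
        have h2 := hσ.2.unipotentPoint hne.symm
        rw [Pi.sub_apply, h1] at h2
        simp at h2
    refine exists_nonalgebraic_measure (g := unipotentPoint v₁) ?_ ?_
      fun d hd v => stabilizer_unipotentPoint hne.symm hd v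
    · rw [hb]
      exact isClosed_iUnion_of_finite fun i => (hcl i).1
    · rw [hb]
      exact ⟨_, Set.mem_iUnion.2 ⟨⟨0, by omega⟩, MulAction.mem_orbit_self _⟩⟩
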